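/- A \emph{squares category} $\mathcal C$ consists of a set of objects, two (small) categories $\mathcal M$ (horizontal morphisms) and $\mathcal E$ (vertical morphisms) on this set of objects, an object $O$ that is initial in both $\mathcal M$ and $\mathcal E$, and a collection of \emph{distinguished squares} $$\begin{array}{ccc} A & \xrightarrow{\,f\,} & B\\ {\scriptstyle g}\downarrow & & \downarrow{\scriptstyle g'}\\ C & \xrightarrow{\,f'\,} & D\end{array}\qquad (f,f'\in\mathcal M,\ g,g'\in\mathcal E)$$ that is closed under horizontal and vertical composition and contains, for every $f\in\mathcal M$, the square with $f$ as both horizontal edges and identities as vertical edges and, for every $g\in\mathcal E$, the square with $g$ as both vertical edges and identities as horizontal edges. Let $T_n\mathcal C$ be the category whose objects are the functors $[n]\to\mathcal M$ and whose morphisms $F\to G$ are the families of vertical morphisms $\alpha_i\colon F(i)\to G(i)$ such that for all $i\le j$ the square with edges $F(i\to j)$, $G(i\to j)$, $\alpha_i$, $\alpha_j$ is distinguished. These form a simplicial category $T_\bullet\mathcal C$, whose levelwise nerve is a bisimplicial set $N_\bullet T_\bullet\mathcal C$. Let $|N_\bullet T_\bullet\mathcal C|$ be the geometric realization of its diagonal,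 and let $K_0^\square(\mathcal C)=\pi_0\,\Omega_O|N_\bullet T_\bullet\mathcal C|=\pi_1(|N_\bullet T_\bullet\mathcal C|,O)$. A distinguished square is a $1$-simplex of the diagonal, from its upper left to its lower right corner. \textbf{Theorem.} Let $\mathcal C$ be a squares category such that for all objects $A,B$ there are an object $X$ and distinguished squares $$\begin{array}{ccc} O & \to & A\\ \downarrow & & \downarrow\\ B & \to & X\end{array}\qquad\text{and}\qquad \begin{array}{ccc} O & \to & B\\ \downarrow & & \downarrow\\ A & \to & X.\end{array}$$ Then $K_0^\square(\mathcal C)$ is isomorphic to the quotient of the free abelian group on the objects of $\mathcal C$ by the relations $[O]=0$ and $[A]+[D]=[B]+[C]$ for every distinguished square with upper left corner $A$, upper right corner $B$, lower left corner $C$ and lower right corner $D$. The isomorphism can be chosen so that $[A]$ corresponds, for every object $A$, to the class of the loop that runs from $O$ to $A$ along the $1$-simplex of the vertical morphism $O\to A$ and returns to $O$ along the $1$-simplex of the horizontal morphism $O\to A$. -/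

import Mathlib

universe u

section

open CategoryTheory Opposite Simplicial

/-- A simple double category: a small double category whose 2-cells are determined by their
boundaries. `catM` is the category of horizontal morphisms and `catE` the category of vertical
morphisms, on the same set of objects. `Dist f f' g g'` says that the square with top edge `f`,
bottom edge `f'`, left edge `g` and right edge `g'` is distinguished. -/
structure SimpleDoubleCategory where
  Ob : Type u
  catM : Category.{u} Ob
  catE : Category.{u} Ob
  Dist : ∀ {A B C D : Ob}, catM.Hom A B → catM.Hom C D → catE.Hom A C → catE.Hom B D → Prop
  dist_vcomp : ∀ {A B C D E F : Ob} {f : catM.Hom A B} {f' : catM.Hom C D} {f'' : catM.Hom E F}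
    {g : catE.Hom A C} {g' : catE.Hom B D} {h : catE.Hom C E} {h' : catE.Hom D F},
    Dist f f' g g' → Dist f' f'' h h' → Dist f f'' (catE.comp g h) (catE.comp g' h')
  dist_hcomp : ∀ {A B C D E F : Ob} {f : catM.Hom A B} {k : catM.Hom B C} {f' : catM.Hom D E}
    {k' : catM.Hom E F} {g : catE.Hom A D} {g' : catE.Hom B E} {g'' : catE.Hom C F},
    Dist f f' g g' → Dist k k' g' g'' → Dist (catM.comp f k) (catM.comp f' k') g g''
  dist_vid : ∀ {A B : Ob} (f : catM.Hom A B), Dist f f (catE.id A) (catE.id B)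
  dist_hid : ∀ {A B : Ob} (g : catE.Hom A B), Dist (catM.id A) (catM.id B) g g

/-- A squares category: a simple double category with a chosen object `O` which is initial both
for the horizontal and for the vertical morphisms. -/
structure SquaresCategory extends SimpleDoubleCategory.{u} where
  O : Ob
  isInitialM : @Limits.IsInitial Ob catM O
  isInitialE : @Limits.IsInitial Ob catE O

namespace SimpleDoubleCategory

variable (C : SimpleDoubleCategory.{u})

/-- The objects of `C`, regarded as the objects of the category of horizontal morphisms. -/
def M : Type u := C.Ob

/-- The objects of `C`, regarded as the objects of the category of vertical morphisms. -/
def E : Type u := C.Ob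

instance : Category.{u} C.M := C.catM

instance : Category.{u} C.E := C.catE

/-- A horizontal functor `D → C`: a functor from `D` to the horizontal morphisms of `C`. -/
structure HFun (D : Type) [Category.{0} D] where
  functor : D ⥤ C.M

variable {C}

namespace HFun

variable {D D' : Type} [Category.{0} D] [Category.{0} D']

/-- A vertical distinguished transformation between horizontal functors. -/
@[ext]
structure Hom (F G : C.HFun D) where
  app : ∀ X : D, C.catE.Hom (F.functor.obj X) (G.functor.obj X)
  dist : ∀ {X Y : D} (f : X ⟶ Y), C.Dist (F.functor.map f) (G.functor.map f) (app X) (app Y)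

/-- The category of horizontal functors and vertical distinguished transformations. -/
instance : Category.{u} (C.HFun D) where
  Hom F G := Hom F G
  id F := ⟨fun X => C.catE.id (F.functor.obj X), fun f => C.dist_vid (F.functor.map f)⟩
  comp α β := ⟨fun X => C.catE.comp (α.app X) (β.app X), fun f => C.dist_vcomp (α.dist f) (β.dist f)⟩
  id_comp α := Hom.ext (funext fun X => C.catE.id_comp (α.app X))
  comp_id α := Hom.ext (funext fun X => C.catE.comp_id (α.app X))
  assoc α β γ := Hom.ext (funext fun X => C.catE.assoc (α.app X) (β.app X) (γ.app X))

/-- Precomposition of horizontal functors with an ordinary functor. -/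
def precomp (C : SimpleDoubleCategory.{u}) (P : D ⥤ D') : C.HFun D' ⥤ C.HFun D where
  obj F := ⟨P ⋙ F.functor⟩
  map α := ⟨fun X => α.app (P.obj X), fun f => α.dist (P.map f)⟩
  map_id _ := rfl
  map_comp _ _ := rfl

end HFun

variable (C)

/-- The simplicial category `T_• C`, with `T_n C` the category of horizontal functors `[n] → C`.
The simplicial operators are given by precomposition. -/
def T : SimplicialObject Cat.{u, u} where
  obj n := Cat.of (C.HFun (Fin (n.unop.len + 1)))
  map f := (HFun.precomp C (SimplexCategory.toCat.map f.unop).toFunctor).toCatHom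
  map_id _ := rfl
  map_comp _ _ := rfl

/-- The bisimplicial set `N_• T_• C`: the first variable is the simplicial direction of `T_• C`
and the second one is the direction of the nerve. -/
def NT : SimplicialObject SSet.{u} := C.T ⋙ nerveFunctor.{u, u}

/-- The diagonal simplicial set of `N_• T_• C`. -/
def diagNT : SSet.{u} :=
  Functor.diag SimplexCategoryᵒᵖ ⋙ Functor.uncurry.obj C.NT

/-- The geometric realization `|N_• T_• C|` of the bisimplicial set `N_• T_• C`, that is, the
geometric realization of its diagonal. -/
noncomputable def realization : TopCat.{u} := SSet.toTop.obj C.diagNT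

variable {C}

/-- An object of `C` as a horizontal functor `[0] → C`. -/
def hFun₀ (A : C.Ob) : C.HFun (Fin 1) := ⟨ComposableArrows.mk₀ (C := C.M) A⟩

/-- A horizontal morphism of `C` as a horizontal functor `[1] → C`. -/
def hFun₁ {A B : C.Ob} (f : C.catM.Hom A B) : C.HFun (Fin 2) :=
  ⟨ComposableArrows.mk₁ (C := C.M) f⟩

/-- A distinguished square as a morphism of `T_1 C`. -/
def squareHom {A B A' B' : C.Ob} {f : C.catM.Hom A B} {f' : C.catM.Hom A' B'}
    {g : C.catE.Hom A A'} {g' : C.catE.Hom B B'} (h : C.Dist f f' g g') :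
    hFun₁ f ⟶ hFun₁ f' where
  app X := match X with
    | 0 => g
    | 1 => g'
  dist := by
    intro X Y k
    match X, Y, k with
    | 0, 0, _ => exact C.dist_hid g
    | 0, 1, _ => exact h
    | 1, 1, _ => exact C.dist_hid g'
    | 1, 0, k => exact absurd (leOfHom k) (by decide)

/-- An object of `C` as a vertex of the diagonal of `N_• T_• C`. -/
def vertex (A : C.Ob) : C.diagNT _⦋0⦌ := ComposableArrows.mk₀ (hFun₀ A)

/-- A distinguished square as a 1-simplex of the diagonal of `N_• T_• C`. -/
def square {A B A' B' : C.Ob} {f : C.catM.Hom A B} {f' : C.catM.Hom A' B'}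
    {g : C.catE.Hom A A'} {g' : C.catE.Hom B B'} (h : C.Dist f f' g g') : C.diagNT _⦋1⦌ :=
  ComposableArrows.mk₁ (squareHom h)

lemma HFun.ext_functor {D : Type} [Category.{0} D] {F G : C.HFun D}
    (h : F.functor = G.functor) : F = G := by
  cases F; cases G; cases h; rfl

/-- A distinguished square as an edge from its upper left corner to its lower right corner. -/
def squareEdge {A B A' B' : C.Ob} {f : C.catM.Hom A B} {f' : C.catM.Hom A' B'}
    {g : C.catE.Hom A A'} {g' : C.catE.Hom B B'} (h : C.Dist f f' g g') :
    SSet.Edge (X := C.diagNT) (vertex A) (vertex B') :=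
  SSet.Edge.mk (square h)
    (ComposableArrows.ext₀ (HFun.ext_functor (ComposableArrows.ext₀ rfl)))
    (ComposableArrows.ext₀ (HFun.ext_functor (ComposableArrows.ext₀ rfl)))

end SimpleDoubleCategory

/-- The point of the geometric realization given by a vertex. -/
noncomputable def SSet.realizationPoint {X : SSet.{u}} (x : X _⦋0⦌) : SSet.toTop.obj X :=
  TopCat.toSSetObj₀Equiv ((sSetTopAdj.unit.app X).app _ x)

lemma SSet.realizationPath_aux {X : SSet.{u}} (s : X _⦋1⦌) (i : Fin 2) (t : unitInterval)
    (hi : stdSimplexHomeomorphUnitInterval (_root_.stdSimplex.vertex (S := ℝ) (i.succAbove 0)) = t)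
    {x : X _⦋0⦌} (hx : X.δ i s = x) :
    TopCat.toSSetObjEquiv _ _ ((sSetTopAdj.unit.app X).app (op ⦋1⦌) s)
      (stdSimplexHomeomorphUnitInterval.symm t) = SSet.realizationPoint x := by
  subst hx
  have h := SSet.δ_naturality_apply (sSetTopAdj.unit.app X) i s
  rw [← hi, Homeomorph.symm_apply_apply, ← _root_.stdSimplex.map_vertex (S := ℝ) i.succAbove 0]
  refine (TopCat.toSSetObjEquiv_δ_apply _ i _).symm.trans ?_
  refine Eq.trans ?_ (congrArg TopCat.toSSetObj₀Equiv h).symm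
  rw [TopCat.toSSetObj₀Equiv_apply]
  exact congrArg _ (Subsingleton.elim _ _)

/-- The characteristic map of a 1-simplex of `X`, as a path in the geometric realization. -/
noncomputable def SSet.Edge.realizationPath {X : SSet.{u}} {x y : X _⦋0⦌} (e : SSet.Edge x y) :
    _root_.Path (SSet.realizationPoint x) (SSet.realizationPoint y) where
  toFun t := TopCat.toSSetObjEquiv _ _ ((sSetTopAdj.unit.app X).app _ e.edge)
    (stdSimplexHomeomorphUnitInterval.symm t)
  continuous_toFun := (ContinuousMap.continuous _).comp
    stdSimplexHomeomorphUnitInterval.symm.continuous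
  source' := SSet.realizationPath_aux e.edge 1 0 rfl e.src_eq
  target' := SSet.realizationPath_aux e.edge 0 1 rfl e.tgt_eq

namespace SquaresCategory

variable (C : SquaresCategory.{u})

/-- The basepoint of `|N_• T_• C|` given by the object `O`. -/
noncomputable def basepoint : C.realization :=
  SSet.realizationPoint (SimpleDoubleCategory.vertex C.O)

/-- `K_0(C)`, the fundamental group of `|N_• T_• C|` at `O`, equivalently the set of components
of the loop space `Ω_O |N_• T_• C|`. -/
abbrev K₀ : Type u := FundamentalGroup C.realization C.basepoint

/-- The path from `O` to `A` in `|N_• T_• C|` along the vertical morphism `O → A`. -/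
noncomputable def pathE (A : C.Ob) :
    Path C.basepoint (SSet.realizationPoint (SimpleDoubleCategory.vertex A)) :=
  (SimpleDoubleCategory.squareEdge
    (C.dist_hid (@Limits.IsInitial.to _ C.catE _ C.isInitialE A))).realizationPath

/-- The path from `O` to `A` in `|N_• T_• C|` along the horizontal morphism `O → A`. -/
noncomputable def pathM (A : C.Ob) :
    Path C.basepoint (SSet.realizationPoint (SimpleDoubleCategory.vertex A)) :=
  (SimpleDoubleCategory.squareEdge
    (C.dist_vid (@Limits.IsInitial.to _ C.catM _ C.isInitialM A))).realizationPath

/-- The class in `K_0(C)` of an object `A`: the loop that goes from `O` to `A` along the vertical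
morphism `O → A` and comes back along the horizontal morphism `O → A`. -/
noncomputable def objClass (A : C.Ob) : C.K₀ :=
  FundamentalGroup.fromPath (Path.Homotopic.Quotient.mk ((C.pathE A).trans (C.pathM A).symm))

/-- There is a distinguished square with the given corners
(upper left, upper right, lower left, lower right). -/
def HasSquare (A B A' B' : C.Ob) : Prop :=
  ∃ (f : C.catM.Hom A B) (f' : C.catM.Hom A' B') (g : C.catE.Hom A A') (g' : C.catE.Hom B B'),
    C.Dist f f' g g'

/-- The subgroup of the free abelian group on the objects generated by `[O]` and by
`[A] + [D] - ([B] + [C])` for all distinguished squares. -/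
def relations : AddSubgroup (FreeAbelianGroup C.Ob) :=
  AddSubgroup.closure
    ({FreeAbelianGroup.of C.O} ∪
      {x | ∃ A B A' B' : C.Ob, C.HasSquare A B A' B' ∧
        x = (FreeAbelianGroup.of A + FreeAbelianGroup.of B') -
          (FreeAbelianGroup.of B + FreeAbelianGroup.of A')})

end SquaresCategory

end

/-! Write e_A and m_A for the paths from `O` to `A` along the vertical and the horizontal morphism,
so that [A] is the loop e_A m_A⁻¹. Take a distinguished square with corners A, B, A', D (upper left,
upper right, lower left, lower right). A 2 by 2 grid of squares is a 2-simplex of the diagonal.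
Grids padded with identity squares show that the path of the square is homotopic both to left edge
then bottom edge and to top edge then right edge. As `O` is initial on both sides, a vertical
morphism A → A' has the path class e_A⁻¹ e_A', and a horizontal one A → B has m_A⁻¹ m_B. Closing the
square up with e_A and e_D⁻¹ therefore gives both [A'] followed by [D]⁻¹ and [A] followed by [B]⁻¹.
Since products in `K₀` are concatenations in reverse order, this reads [D]⁻¹[A'] = [B]⁻¹[A]
(`objClass_square`). For the two squares of the hypothesis it gives [B][A] = [X] = [A][B]. So the
object classes commute, and once they generate `K₀` the presented group maps to it.

Surjectivity: every loop at `O` is homotopic to a path along edges and reversed edges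
(`SSet.edge_induction`), and each edge, closed up by vertical paths to `O`, is the class [D]⁻¹[A']
of a square (`closure_objClass`). The topological input is `SSet.class_of_simplices`: paths are
compact, hence lie in a skeleton, and can be pushed cell by cell into lower skeleta.

Injectivity: a left inverse is built from the 1-cocycle sending a square to [A] - [B] in the
presented group (`exists_hom_presented`). A cocycle with values in G yields a homomorphism on the
fundamental group by mapping the realization to the base of an explicit covering with group G and
taking monodromy (`SSet.Potential.exists_hom`). The total space consists of functions [0,1) → G, and
a simplex with barycentric coordinates a goes to the step function with step lengths a. -/

section

open CategoryTheory Opposite Simplicial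

/-! ### Characteristic maps and descent to the geometric realization. -/

namespace SSet

/-- The characteristic map of an `n`-simplex of `X`. -/
noncomputable def charMap {X : SSet.{u}} {n : ℕ} (s : X _⦋n⦌) :
    C(_root_.stdSimplex ℝ (Fin (n + 1)), SSet.toTop.obj X) :=
  TopCat.toSSetObjEquiv _ _ ((sSetTopAdj.unit.app X).app _ s)

/-- The affine map between topological simplices induced by a morphism of `SimplexCategory`. -/
noncomputable def simplexMap {m n : ℕ} (f : ⦋m⦌ ⟶ ⦋n⦌) :
    C(_root_.stdSimplex ℝ (Fin (m + 1)), _root_.stdSimplex ℝ (Fin (n + 1))) :=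
  ⟨_root_.stdSimplex.map f, _root_.stdSimplex.continuous_map _⟩

lemma simplexMap_comp {l m n : ℕ} (f : ⦋l⦌ ⟶ ⦋m⦌) (g : ⦋m⦌ ⟶ ⦋n⦌)
    (a : _root_.stdSimplex ℝ (Fin (l + 1))) :
    simplexMap (f ≫ g) a = simplexMap g (simplexMap f a) :=
  (_root_.stdSimplex.map_comp_apply (f : Fin (l + 1) → Fin (m + 1)) g a).symm

lemma simplexMap_id {n : ℕ} (a : _root_.stdSimplex ℝ (Fin (n + 1))) :
    simplexMap (𝟙 ⦋n⦌) a = a :=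
  _root_.stdSimplex.map_id_apply a

lemma simplexMap_vertex {m n : ℕ} (f : ⦋m⦌ ⟶ ⦋n⦌) (i : Fin (m + 1)) :
    simplexMap f (_root_.stdSimplex.vertex i) = _root_.stdSimplex.vertex (f i) :=
  _root_.stdSimplex.map_vertex (S := ℝ) (f : Fin (m + 1) → Fin (n + 1)) i

variable {X : SSet.{u}}

lemma charMap_map {m n : ℕ} (f : ⦋m⦌ ⟶ ⦋n⦌) (s : X _⦋n⦌) :
    charMap (X.map f.op s) = (charMap s).comp (simplexMap f) := by
  have h := NatTrans.naturality_apply (sSetTopAdj.unit.app X) f.op s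
  exact congrArg (TopCat.toSSetObjEquiv _ (op ⦋m⦌)) h

lemma charMap_map_apply {m n : ℕ} (f : ⦋m⦌ ⟶ ⦋n⦌) (s : X _⦋n⦌)
    (a : _root_.stdSimplex ℝ (Fin (m + 1))) :
    charMap (X.map f.op s) a = charMap s (simplexMap f a) := by
  rw [charMap_map]; rfl

/-- A compatible family of continuous maps on the simplices of `X` descends to the realization. -/
lemma exists_desc {Z : Type u} [TopologicalSpace Z]
    (c : ∀ n : ℕ, X _⦋n⦌ → C(_root_.stdSimplex ℝ (Fin (n + 1)), Z))
    (hc : ∀ (m n : ℕ) (f : ⦋m⦌ ⟶ ⦋n⦌) (s : X _⦋n⦌),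
      c m (X.map f.op s) = (c n s).comp (simplexMap f)) :
    ∃ F : C(SSet.toTop.obj X, Z), ∀ (n : ℕ) (s : X _⦋n⦌), F.comp (charMap s) = c n s := by
  let φ : X ⟶ TopCat.toSSet.obj (TopCat.of Z) :=
    { app := fun n => ↾(fun s => (TopCat.toSSetObjEquiv (TopCat.of Z) n).symm (c n.unop.len s))
      naturality := by
        intro n m f
        ext s
        exact congrArg (TopCat.toSSetObjEquiv (TopCat.of Z) m).symm (hc m.unop.len n.unop.len f.unop s) }
  refine ⟨((sSetTopAdj.homEquiv X (TopCat.of Z)).symm φ).hom, fun n s => ?_⟩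
  have h : sSetTopAdj.unit.app X ≫ TopCat.toSSet.map ((sSetTopAdj.homEquiv X (TopCat.of Z)).symm φ)
      = φ := by
    exact (Adjunction.homEquiv_unit ..).symm.trans (Equiv.apply_symm_apply _ _)
  have h2 := congrArg (fun (ψ : X ⟶ TopCat.toSSet.obj (TopCat.of Z)) =>
    TopCat.toSSetObjEquiv (TopCat.of Z) _ (ψ.app (op ⦋n⦌) s)) h
  exact h2

lemma hom_ext_charMap {Z : Type u} [TopologicalSpace Z] {F G : C(SSet.toTop.obj X, Z)}
    (h : ∀ (n : ℕ) (s : X _⦋n⦌), F.comp (charMap s) = G.comp (charMap s)) : F = G := by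
  suffices TopCat.ofHom F = TopCat.ofHom G from congrArg TopCat.Hom.hom this
  apply (sSetTopAdj.homEquiv X (TopCat.of Z)).injective
  ext n s
  apply (TopCat.toSSetObjEquiv (TopCat.of Z) n).injective
  exact h n.unop.len s

/-- Descent for maps of sets. -/
lemma exists_desc_fun {Z : Type u}
    (c : ∀ n : ℕ, X _⦋n⦌ → _root_.stdSimplex ℝ (Fin (n + 1)) → Z)
    (hc : ∀ (m n : ℕ) (f : ⦋m⦌ ⟶ ⦋n⦌) (s : X _⦋n⦌) (a),
      c m (X.map f.op s) a = c n s (simplexMap f a)) :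
    ∃ F : SSet.toTop.obj X → Z, ∀ (n : ℕ) (s : X _⦋n⦌) a, F (charMap s a) = c n s a := by
  -- For the indiscrete topology every map into `Z` is continuous, so continuous descent gives
  -- descent of bare functions.
  let _ : TopologicalSpace Z := ⊤
  obtain ⟨F, hF⟩ := exists_desc (X := X) (Z := Z) (fun n s => ⟨c n s, continuous_top⟩)
    (fun m n f s => by ext a; exact hc m n f s a)
  exact ⟨F, fun n s a => congrArg (fun g : C(_, Z) => g a) (hF n s)⟩

/-- Being in the image of some characteristic map and being true are two maps to an indiscrete
`Prop` that agree on all simplices, hence agree. -/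
lemma exists_charMap_eq (x : SSet.toTop.obj X) :
    ∃ (n : ℕ) (s : X _⦋n⦌) (a : _root_.stdSimplex ℝ (Fin (n + 1))), charMap s a = x := by
  let _ : TopologicalSpace (ULift.{u} Prop) := ⊤
  let F : C(SSet.toTop.obj X, ULift.{u} Prop) :=
    ⟨fun x => ⟨∃ (n : ℕ) (s : X _⦋n⦌) (a : _root_.stdSimplex ℝ (Fin (n + 1))), charMap s a = x⟩,
      continuous_top⟩
  let G : C(SSet.toTop.obj X, ULift.{u} Prop) := ⟨fun x => ⟨True⟩, continuous_top⟩
  have h : F = G := hom_ext_charMap (by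
    intro n s
    ext a
    exact ⟨fun _ => trivial, fun _ => ⟨n, s, a, rfl⟩⟩)
  have h2 := congrArg (fun g : C(SSet.toTop.obj X, ULift.{u} Prop) => (g x).down) h
  exact h2.mpr trivial

lemma continuous_of_charMap {Z : Type u} [TopologicalSpace Z] {g : SSet.toTop.obj X → Z}
    (hg : ∀ (n : ℕ) (s : X _⦋n⦌), Continuous (g ∘ charMap s)) : Continuous g := by
  obtain ⟨F, hF⟩ := exists_desc (X := X) (Z := Z) (fun n s => ⟨g ∘ charMap s, hg n s⟩)
    (fun m n f s => by
      ext a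
      exact congrArg g (charMap_map_apply f s a))
  have hF2 : F = g := by
    ext x
    obtain ⟨n, s, a, rfl⟩ := exists_charMap_eq x
    exact congrArg (fun g : C(_, Z) => g a) (hF n s)
  exact hF2 ▸ F.continuous

lemma isOpen_of_charMap {U : Set (SSet.toTop.obj X)}
    (hU : ∀ (n : ℕ) (s : X _⦋n⦌), IsOpen (charMap s ⁻¹' U)) : IsOpen U := by
  -- `Prop` carries the Sierpiński topology, in which a predicate is continuous exactly when it
  -- defines an open set.
  have h : Continuous (fun x : SSet.toTop.obj X => ULift.up.{u} (x ∈ U)) := by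
    refine continuous_of_charMap fun n s => ?_
    exact continuous_uliftUp.comp (continuous_Prop.2 (hU n s))
  exact continuous_Prop.1 (continuous_uliftDown.comp h)

lemma isClosed_of_charMap {U : Set (SSet.toTop.obj X)}
    (hU : ∀ (n : ℕ) (s : X _⦋n⦌), IsClosed (charMap s ⁻¹' U)) : IsClosed U :=
  ⟨isOpen_of_charMap fun n s => (hU n s).isOpen_compl⟩

end SSet

end

/-! ### Normal forms of points: a nondegenerate simplex with an interior point. -/

section

open CategoryTheory Opposite Simplicial

namespace SSet

lemma simplexMap_apply {m n : ℕ} (f : ⦋m⦌ ⟶ ⦋n⦌) (a : _root_.stdSimplex ℝ (Fin (m + 1)))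
    (j : Fin (n + 1)) : simplexMap f a j = ∑ i with f i = j, a i :=
  FunOnFinite.linearMap_apply_apply ℝ ℝ (f : Fin (m + 1) → Fin (n + 1)) a j

lemma simplexMap_pos_iff {m n : ℕ} (f : ⦋m⦌ ⟶ ⦋n⦌) (a : _root_.stdSimplex ℝ (Fin (m + 1)))
    (j : Fin (n + 1)) : 0 < simplexMap f a j ↔ ∃ i, f i = j ∧ 0 < a i := by
  rw [simplexMap_apply, Finset.sum_pos_iff_of_nonneg (fun i _ => _root_.stdSimplex.zero_le a i)]
  simp

lemma simplexMap_pos_of_epi {m n : ℕ} (f : ⦋m⦌ ⟶ ⦋n⦌) [Epi f]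
    {a : _root_.stdSimplex ℝ (Fin (m + 1))} (ha : ∀ i, 0 < a i) (j : Fin (n + 1)) :
    0 < simplexMap f a j := by
  rw [simplexMap_pos_iff]
  obtain ⟨i, hi⟩ := SimplexCategory.epi_iff_surjective.1 (inferInstance : Epi f) j
  exact ⟨i, hi, ha i⟩

lemma simplexMap_apply_of_mono {m n : ℕ} (f : ⦋m⦌ ⟶ ⦋n⦌) [Mono f]
    (a : _root_.stdSimplex ℝ (Fin (m + 1))) (i : Fin (m + 1)) :
    simplexMap f a (f i) = a i := by
  have hf : Function.Injective f := SimplexCategory.mono_iff_injective.1 inferInstance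
  rw [simplexMap_apply, Finset.sum_eq_single i]
  · intro j hj hne
    exact absurd (hf (by simpa using hj)) hne
  · simp

lemma simplexMap_injective {m n : ℕ} (f : ⦋m⦌ ⟶ ⦋n⦌) [Mono f] :
    Function.Injective (simplexMap f) := by
  intro a b h
  ext i
  rw [← simplexMap_apply_of_mono f a, ← simplexMap_apply_of_mono f b, h]

lemma exists_interior_face {m : ℕ} (a : _root_.stdSimplex ℝ (Fin (m + 1))) :
    ∃ (k : ℕ) (f : ⦋k⦌ ⟶ ⦋m⦌) (_ : Mono f) (b : _root_.stdSimplex ℝ (Fin (k + 1))),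
      (∀ i, 0 < b i) ∧ simplexMap f b = a := by
  classical
  let s : Finset (Fin (m + 1)) := Finset.univ.filter fun i => 0 < a i
  have hs : s.Nonempty := by
    by_contra h
    rw [Finset.not_nonempty_iff_eq_empty] at h
    have h0 : ∀ i, a i = 0 := fun i => le_antisymm (not_lt.1 fun hi => by
      have : i ∈ s := by simp [s, hi]
      simp [h] at this) (a.2.1 i)
    have := _root_.stdSimplex.sum_eq_one a
    simp [h0] at this
  obtain ⟨k, hk⟩ : ∃ k, s.card = k + 1 := ⟨s.card - 1, by have := hs.card_pos; omega⟩
  let e := s.orderEmbOfFin hk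
  let f : ⦋k⦌ ⟶ ⦋m⦌ := SimplexCategory.Hom.mk ⟨e, e.monotone⟩
  have hf : Mono f := SimplexCategory.mono_iff_injective.2 e.injective
  have hsum : ∑ i, a (e i) = 1 := by
    rw [← _root_.stdSimplex.sum_eq_one a]
    have h1 : ∑ i, a (e i) = ∑ j ∈ s, a j := by
      rw [← Finset.sum_coe_sort s, ← (s.orderIsoOfFin hk).toEquiv.sum_comp]
      rfl
    rw [h1]
    refine Finset.sum_subset (Finset.subset_univ _) fun j _ hj => ?_
    exact le_antisymm (not_lt.1 fun h => hj (by simp [s, h])) (a.2.1 j)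
  let b : _root_.stdSimplex ℝ (Fin (k + 1)) := ⟨fun i => a (e i), fun i => a.2.1 _, hsum⟩
  refine ⟨k, f, hf, b, fun i => ?_, ?_⟩
  · have : e i ∈ s := s.orderEmbOfFin_mem hk i
    exact (Finset.mem_filter.1 this).2
  · ext j
    by_cases hj : j ∈ s
    · obtain ⟨i, rfl⟩ : ∃ i, e i = j := by
        have : j ∈ Set.range e := by rw [Finset.range_orderEmbOfFin]; exact hj
        exact this
      exact simplexMap_apply_of_mono f b i
    · have h1 : a j = 0 := le_antisymm (not_lt.1 fun h => hj (by simp [s, h])) (a.2.1 j)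
      have h2 : ¬ 0 < simplexMap f b j := by
        rw [simplexMap_pos_iff]
        rintro ⟨i, rfl, hi⟩
        exact hj (s.orderEmbOfFin_mem hk i)
      rw [h1]
      exact le_antisymm (not_lt.1 h2) ((simplexMap f b).2.1 j)

/-- The range of the face map is the support of the image point, so the point determines its carrier
face. -/
lemma interior_face_dim_unique {m k₁ k₂ : ℕ} {f₁ : ⦋k₁⦌ ⟶ ⦋m⦌} {f₂ : ⦋k₂⦌ ⟶ ⦋m⦌} [Mono f₁] [Mono f₂]
    {b₁ : _root_.stdSimplex ℝ (Fin (k₁ + 1))} {b₂ : _root_.stdSimplex ℝ (Fin (k₂ + 1))}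
    (h₁ : ∀ i, 0 < b₁ i) (h₂ : ∀ i, 0 < b₂ i) (h : simplexMap f₁ b₁ = simplexMap f₂ b₂) :
    k₁ = k₂ := by
  classical
  have key : ∀ {k₁ k₂ : ℕ} {f₁ : ⦋k₁⦌ ⟶ ⦋m⦌} {f₂ : ⦋k₂⦌ ⟶ ⦋m⦌} [Mono f₁]
      {b₁ : _root_.stdSimplex ℝ (Fin (k₁ + 1))} {b₂ : _root_.stdSimplex ℝ (Fin (k₂ + 1))},
      (∀ i, 0 < b₁ i) → simplexMap f₁ b₁ = simplexMap f₂ b₂ → k₁ ≤ k₂ := by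
    intro k₁ k₂ f₁ f₂ _ b₁ b₂ h₁ h
    have hr : ∀ i, ∃ j, f₂ j = f₁ i := fun i => by
      have : 0 < simplexMap f₁ b₁ (f₁ i) := (simplexMap_pos_iff _ _ _).2 ⟨i, rfl, h₁ i⟩
      rw [h, simplexMap_pos_iff] at this
      obtain ⟨j, hj, -⟩ := this
      exact ⟨j, hj⟩
    choose g hg using hr
    have hf : Function.Injective f₁ := SimplexCategory.mono_iff_injective.1 inferInstance
    have hg' : Function.Injective g := fun i j hij => hf (by rw [← hg, ← hg, hij])
    have := Fintype.card_le_of_injective g hg'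
    simpa using this
  exact le_antisymm (key h₁ h) (key h₂ h.symm)

lemma interior_face_map_unique {m k : ℕ} {f₁ f₂ : ⦋k⦌ ⟶ ⦋m⦌} [Mono f₁] [Mono f₂]
    {b₁ b₂ : _root_.stdSimplex ℝ (Fin (k + 1))}
    (h₁ : ∀ i, 0 < b₁ i) (h₂ : ∀ i, 0 < b₂ i) (h : simplexMap f₁ b₁ = simplexMap f₂ b₂) :
    f₁ = f₂ := by
  have hf₁ : Function.Injective f₁ := SimplexCategory.mono_iff_injective.1 inferInstance
  have hf₂ : Function.Injective f₂ := SimplexCategory.mono_iff_injective.1 inferInstance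
  have hr : Set.range f₁ = Set.range f₂ := by
    ext j
    have e : ∀ (f : ⦋k⦌ ⟶ ⦋m⦌) (b : _root_.stdSimplex ℝ (Fin (k + 1))), (∀ i, 0 < b i) →
        (j ∈ Set.range f ↔ 0 < simplexMap f b j) := by
      intro f b hb
      rw [simplexMap_pos_iff]
      exact ⟨fun ⟨i, hi⟩ => ⟨i, hi, hb i⟩, fun ⟨i, hi, _⟩ => ⟨i, hi⟩⟩
    rw [e f₁ b₁ h₁, e f₂ b₂ h₂, h]
  have m₁ : StrictMono f₁ := f₁.toOrderHom.monotone.strictMono_of_injective hf₁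
  have m₂ : StrictMono f₂ := f₂.toOrderHom.monotone.strictMono_of_injective hf₂
  have := (StrictMono.range_inj m₁ m₂).1 hr
  ext i : 3
  exact congrFun this i

lemma exists_epi_mono_fac {m n : ℕ} (f : ⦋m⦌ ⟶ ⦋n⦌) :
    ∃ (k : ℕ) (e : ⦋m⦌ ⟶ ⦋k⦌) (i : ⦋k⦌ ⟶ ⦋n⦌) (_ : Epi e) (_ : Mono i), e ≫ i = f :=
  ⟨(Limits.image f).len, Limits.factorThruImage f, Limits.image.ι f, inferInstance, inferInstance,
    Limits.image.fac f⟩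

variable {X : SSet.{u}}

lemma map_comp_apply' {l m n : ℕ} (f : ⦋l⦌ ⟶ ⦋m⦌) (g : ⦋m⦌ ⟶ ⦋n⦌) (s : X _⦋n⦌) :
    X.map (f ≫ g).op s = X.map f.op (X.map g.op s) := by
  rw [op_comp, Functor.map_comp, comp_apply]

/-- Uniqueness of the factorization through a nondegenerate simplex, in a packaged form. -/
lemma nonDegenerate_unique {k n₁ n₂ : ℕ} {f₁ : ⦋k⦌ ⟶ ⦋n₁⦌} {f₂ : ⦋k⦌ ⟶ ⦋n₂⦌} [Epi f₁] [Epi f₂]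
    {s₁ : X _⦋n₁⦌} {s₂ : X _⦋n₂⦌} (h₁ : s₁ ∈ X.nonDegenerate n₁) (h₂ : s₂ ∈ X.nonDegenerate n₂)
    (h : X.map f₁.op s₁ = X.map f₂.op s₂) :
    (⟨n₁, f₁, s₁⟩ : Σ n : ℕ, (⦋k⦌ ⟶ ⦋n⦌) × X _⦋n⦌) = ⟨n₂, f₂, s₂⟩ := by
  obtain rfl := unique_nonDegenerate_dim X _ f₁ ⟨s₁, h₁⟩ rfl f₂ ⟨s₂, h₂⟩ h
  have e := unique_nonDegenerate_simplex X _ f₁ ⟨s₁, h₁⟩ rfl f₂ ⟨s₂, h₂⟩ h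
  obtain rfl := unique_nonDegenerate_map X _ f₁ ⟨s₁, h₁⟩ rfl f₂ ⟨s₂, h₂⟩ h
  obtain rfl : s₁ = s₂ := congrArg Subtype.val e
  rfl

/-- `normalForms s a` consists of the nondegenerate simplices together with an interior point that
arise from `(s, a)` by passing to the carrier face of `a` and removing degeneracies. -/
def normalForms {m : ℕ} (s : X _⦋m⦌) (a : _root_.stdSimplex ℝ (Fin (m + 1))) :
    Set (Σ n : ℕ, X _⦋n⦌ × _root_.stdSimplex ℝ (Fin (n + 1))) :=
  {p | p.2.1 ∈ X.nonDegenerate p.1 ∧ ∃ (k : ℕ) (i : ⦋k⦌ ⟶ ⦋m⦌) (e : ⦋k⦌ ⟶ ⦋p.1⦌)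
    (b : _root_.stdSimplex ℝ (Fin (k + 1))), Mono i ∧ Epi e ∧ (∀ j, 0 < b j) ∧
      simplexMap i b = a ∧ simplexMap e b = p.2.2 ∧ X.map i.op s = X.map e.op p.2.1}

lemma normalForms_nonempty {m : ℕ} (s : X _⦋m⦌) (a : _root_.stdSimplex ℝ (Fin (m + 1))) :
    (normalForms s a).Nonempty := by
  obtain ⟨k, i, hi, b, hb, hab⟩ := exists_interior_face a
  obtain ⟨n, e, he, ⟨y, hy⟩, h⟩ := X.exists_nonDegenerate (X.map i.op s)
  exact ⟨⟨n, y, simplexMap e b⟩, hy, k, i, e, b, hi, he, hb, hab, rfl, h⟩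

lemma normalForms_subsingleton {m : ℕ} (s : X _⦋m⦌) (a : _root_.stdSimplex ℝ (Fin (m + 1))) :
    (normalForms s a).Subsingleton := by
  rintro ⟨n₁, y₁, c₁⟩ ⟨hy₁, k₁, i₁, e₁, b₁, _, _, hb₁, hab₁, hc₁, h₁⟩
    ⟨n₂, y₂, c₂⟩ ⟨hy₂, k₂, i₂, e₂, b₂, _, _, hb₂, hab₂, hc₂, h₂⟩
  dsimp only at *
  obtain rfl := interior_face_dim_unique hb₁ hb₂ (hab₁.trans hab₂.symm)
  obtain rfl := interior_face_map_unique hb₁ hb₂ (hab₁.trans hab₂.symm)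
  obtain rfl := simplexMap_injective i₁ (hab₁.trans hab₂.symm)
  have := nonDegenerate_unique hy₁ hy₂ (h₁.symm.trans h₂)
  cases this
  rw [← hc₁, ← hc₂]

lemma normalForms_map {m n : ℕ} (f : ⦋m⦌ ⟶ ⦋n⦌) (s : X _⦋n⦌)
    (a : _root_.stdSimplex ℝ (Fin (m + 1))) :
    normalForms (X.map f.op s) a = normalForms s (simplexMap f a) := by
  have key : normalForms (X.map f.op s) a ⊆ normalForms s (simplexMap f a) := by
    rintro ⟨n₁, y₁, c₁⟩ ⟨hy₁, k₁, i₁, e₁, b₁, _, _, hb₁, hab₁, hc₁, h₁⟩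
    dsimp only at *
    obtain ⟨l, e, i, he, hi, hei⟩ := exists_epi_mono_fac (i₁ ≫ f)
    obtain ⟨n₂, e₂, he₂, ⟨y₂, hy₂⟩, h₂⟩ := X.exists_nonDegenerate (X.map i.op s)
    have h3 : X.map (e ≫ e₂).op y₂ = X.map e₁.op y₁ := by
      rw [← h₁, ← map_comp_apply', ← hei, map_comp_apply', map_comp_apply', h₂]
    have := nonDegenerate_unique hy₂ hy₁ h3
    cases this
    refine ⟨hy₁, l, i, e₂, simplexMap e b₁, hi, he₂, simplexMap_pos_of_epi e hb₁, ?_, ?_, h₂⟩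
    · rw [← simplexMap_comp, hei, simplexMap_comp, hab₁]
    · rw [← simplexMap_comp]; exact hc₁
  -- Both sets have exactly one element, so one inclusion is enough.
  refine key.antisymm fun p hp => ?_
  obtain ⟨q, hq⟩ := normalForms_nonempty (X.map f.op s) a
  rwa [normalForms_subsingleton _ _ hp (key hq)]

/-- Invariance under simplicial operators makes `normalForms` a function on the realization. -/
lemma normalForms_congr {m n : ℕ} {s : X _⦋m⦌} {t : X _⦋n⦌}
    {a : _root_.stdSimplex ℝ (Fin (m + 1))} {b : _root_.stdSimplex ℝ (Fin (n + 1))}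
    (h : charMap s a = charMap t b) : normalForms s a = normalForms t b := by
  obtain ⟨F, hF⟩ := exists_desc_fun (X := X) (fun n s a => normalForms s a)
    (fun m n f s a => normalForms_map f s a)
  rw [← hF, ← hF, h]

lemma normalForms_of_nonDegenerate {n : ℕ} {s : X _⦋n⦌} (hs : s ∈ X.nonDegenerate n)
    {a : _root_.stdSimplex ℝ (Fin (n + 1))} (ha : ∀ i, 0 < a i) :
    ⟨n, s, a⟩ ∈ normalForms s a :=
  ⟨hs, n, 𝟙 _, 𝟙 _, a, inferInstance, inferInstance, ha, simplexMap_id a, simplexMap_id a, rfl⟩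

/-- Every point of the realization has a unique normal form. -/
lemma exists_normalForm (x : SSet.toTop.obj X) :
    ∃ (n : ℕ) (s : X _⦋n⦌) (a : _root_.stdSimplex ℝ (Fin (n + 1))), s ∈ X.nonDegenerate n ∧
      (∀ i, 0 < a i) ∧ charMap s a = x := by
  obtain ⟨m, t, b, rfl⟩ := exists_charMap_eq x
  obtain ⟨⟨n, s, a⟩, hs, k, i, e, c, _, _, hc, hi, he, h⟩ := normalForms_nonempty t b
  dsimp only at *
  refine ⟨n, s, a, hs, ?_, ?_⟩
  · rw [← he]; exact simplexMap_pos_of_epi e hc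
  · rw [← he, ← hi, ← charMap_map_apply, ← charMap_map_apply, h]

/-- A representative of a point with given normal form maps to the normal form. -/
lemma exists_of_charMap_eq {m n : ℕ} {t : X _⦋m⦌} {b : _root_.stdSimplex ℝ (Fin (m + 1))}
    {s : X _⦋n⦌} (hs : s ∈ X.nonDegenerate n)
    {a : _root_.stdSimplex ℝ (Fin (n + 1))} (ha : ∀ i, 0 < a i) (h : charMap t b = charMap s a) :
    ∃ (k : ℕ) (i : ⦋k⦌ ⟶ ⦋m⦌) (e : ⦋k⦌ ⟶ ⦋n⦌) (c : _root_.stdSimplex ℝ (Fin (k + 1))),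
      Mono i ∧ Epi e ∧ simplexMap i c = b ∧ simplexMap e c = a ∧ X.map i.op t = X.map e.op s := by
  have h1 := normalForms_of_nonDegenerate hs ha
  rw [← normalForms_congr h] at h1
  obtain ⟨-, k, i, e, c, hi, he, -, h2, h3, h4⟩ := h1
  exact ⟨k, i, e, c, hi, he, h2, h3, h4⟩

lemma normalForm_unique {n₁ n₂ : ℕ} {s₁ : X _⦋n₁⦌} {s₂ : X _⦋n₂⦌}
    (h₁ : s₁ ∈ X.nonDegenerate n₁) (h₂ : s₂ ∈ X.nonDegenerate n₂)
    {a₁ : _root_.stdSimplex ℝ (Fin (n₁ + 1))} {a₂ : _root_.stdSimplex ℝ (Fin (n₂ + 1))}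
    (ha₁ : ∀ i, 0 < a₁ i) (ha₂ : ∀ i, 0 < a₂ i) (h : charMap s₁ a₁ = charMap s₂ a₂) :
    (⟨n₁, s₁, a₁⟩ : Σ n : ℕ, X _⦋n⦌ × _root_.stdSimplex ℝ (Fin (n + 1))) = ⟨n₂, s₂, a₂⟩ := by
  have e₁ := normalForms_of_nonDegenerate h₁ ha₁
  rw [normalForms_congr h] at e₁
  exact normalForms_subsingleton _ _ e₁ (normalForms_of_nonDegenerate h₂ ha₂)

end SSet

end

/-! ### Classes of paths closed under concatenation: subdivision and homotopy. -/

section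

open CategoryTheory Opposite Simplicial unitInterval

namespace ContinuousMap

variable {Y : Type u} [TopologicalSpace Y]

/-- A continuous map on the unit interval, as a path between its endpoints. -/
def toPath (f : C(I, Y)) : Path (f 0) (f 1) := ⟨f, rfl, rfl⟩

/-- A class of homotopy classes of paths that is closed under concatenation. -/
structure _root_.Path.TransClosed (T : ∀ y y' : Y, Path.Homotopic.Quotient y y' → Prop) :
    Prop where
  trans : ∀ {x y z : Y} {p : Path.Homotopic.Quotient x y} {q : Path.Homotopic.Quotient y z},
    T _ _ p → T _ _ q → T _ _ (p.trans q)

variable {T : ∀ y y' : Y, Path.Homotopic.Quotient y y' → Prop}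

lemma _root_.Path.class_cast_iff {x y x' y' : Y} (p : Path.Homotopic.Quotient x y) (hx : x' = x)
    (hy : y' = y) : T _ _ (p.cast hx hy) ↔ T _ _ p := by
  subst hx hy
  rw [Path.Homotopic.Quotient.cast_rfl_rfl]

lemma _root_.Path.class_mk_iff {x y : Y} (p : Path x y) :
    T _ _ (.mk p) ↔ T _ _ (.mk (toPath (p : C(I, Y)))) :=
  (Path.class_cast_iff (T := T) (.mk p) p.source p.target).symm

/-- By a Lebesgue number argument the path is homotopic to a concatenation of finitely many pieces,
each with parameters in one member of the cover. -/
lemma _root_.Path.TransClosed.of_cover (hT : Path.TransClosed T) (f : C(I, Y)) {ι : Type*}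
    {c : ι → Set I} (hc : ∀ i, IsOpen (c i)) (hcov : Set.univ ⊆ ⋃ i, c i)
    (h : ∀ (i : ι) (g : C(I, I)), (∀ t, g t ∈ c i) → T _ _ (.mk (toPath (f.comp g)))) :
    T _ _ (.mk (toPath f)) := by
  obtain ⟨t, ht0, htm, ⟨N, hN⟩, ht⟩ := exists_monotone_Icc_subset_open_cover_unitInterval hc hcov
  have hsub : ∀ (i : ι) (t₀ t₁ : I), t₀ ≤ t₁ → Set.Icc t₀ t₁ ⊆ c i →
      T _ _ (.mk ((toPath f).subpath t₀ t₁)) := by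
    intro i t₀ t₁ h01 hi
    refine (Path.class_mk_iff (T := T) _).2 ?_
    refine h i ⟨Set.Icc.convexComb t₀ t₁, by fun_prop⟩ fun s => hi ?_
    have := Path.range_subpathAux t₀ t₁
    rw [Set.uIcc_of_le h01] at this
    rw [← this]
    exact ⟨s, rfl⟩
  have key : ∀ n, T _ _ (.mk ((toPath f).subpath 0 (t n))) := by
    intro n
    induction n with
    | zero =>
      obtain ⟨i, hi⟩ := ht 0
      rw [ht0]
      exact hsub i 0 0 le_rfl (fun x hx => hi ⟨by rw [ht0]; exact hx.1, hx.2.trans zero_le⟩)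
    | succ n ih =>
      obtain ⟨i, hi⟩ := ht n
      have h1 := hT.trans ih (hsub i _ _ (htm (Nat.le_succ n)) hi)
      rw [← Path.Homotopic.Quotient.mk_trans] at h1
      rwa [Path.Homotopic.Quotient.eq.2 ⟨Path.Homotopy.subpathTransSubpath (toPath f) 0 (t n) (t (n+1))⟩] at h1
  have := key N
  rw [hN N le_rfl, Path.subpath_zero_one] at this
  exact this

/-- A free homotopy gives f ≃ H(·,0) · g · H(·,1)⁻¹, where the outer factors are the tracks of the
endpoints. -/
lemma _root_.Path.TransClosed.of_homotopy (hT : Path.TransClosed T) {f g : C(I, Y)}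
    (H : f.Homotopy g)
    (h0 : T _ _ (.mk (H.evalAt 0))) (h1 : T _ _ (.mk (H.evalAt 1).symm))
    (hg : T _ _ (.mk (toPath g))) : T _ _ (.mk (toPath f)) := by
  let p : Path (0 : I) 1 := ⟨ContinuousMap.id I, rfl, rfl⟩
  have h := Path.Homotopic.Quotient.eq.2 (Path.Homotopic.map_trans_evalAt H p)
  have e : (Path.Homotopic.Quotient.mk (toPath f)) =
      ((Path.Homotopic.Quotient.mk (H.evalAt 0)).trans (.mk (toPath g))).trans
        (.mk (H.evalAt 1).symm) := by
    have h' : (Path.Homotopic.Quotient.mk (toPath f)).trans (.mk (H.evalAt 1)) =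
      (Path.Homotopic.Quotient.mk (H.evalAt 0)).trans (.mk (toPath g)) := h
    rw [← h', Path.Homotopic.Quotient.mk_symm, Path.Homotopic.Quotient.trans_assoc,
      Path.Homotopic.Quotient.trans_symm, Path.Homotopic.Quotient.trans_refl]
  rw [e]
  exact hT.trans (hT.trans h0 hg) h1

end ContinuousMap
end

/-! ### Closed sets, skeleta and extension over cells. -/

section

open CategoryTheory Opposite Simplicial unitInterval

namespace SSet

variable {X : SSet.{u}}

lemma map_injective_of_epi {k n : ℕ} (e : ⦋k⦌ ⟶ ⦋n⦌) [Epi e] :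
    Function.Injective (X.map e.op) := by
  obtain ⟨⟨he⟩⟩ := isSplitEpi_of_epi e
  intro s t h
  have h2 := congrArg (X.map he.section_.op) h
  rw [← map_comp_apply', ← map_comp_apply', he.id] at h2
  simpa using h2

/-- A subset of the realization is closed if it is covered by closed subsets of simplices that
contain all normal forms of its points. -/
lemma isClosed_of_normalForm {C : Set (SSet.toTop.obj X)}
    (D : ∀ n : ℕ, X _⦋n⦌ → Set (_root_.stdSimplex ℝ (Fin (n + 1))))
    (hD : ∀ n s, IsClosed (D n s)) (hDC : ∀ n s, ∀ a ∈ D n s, charMap s a ∈ C)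
    (hCD : ∀ (n : ℕ) (s : X _⦋n⦌) (a : _root_.stdSimplex ℝ (Fin (n + 1))),
      s ∈ X.nonDegenerate n → (∀ i, 0 < a i) → charMap s a ∈ C → a ∈ D n s) :
    IsClosed C := by
  refine isClosed_of_charMap fun m t => ?_
  -- Normal forms arise by a face followed by removing degeneracies, so dimensions never exceed `m`
  -- and the index set is finite. For given `i` and epi `e` the simplex `s` is unique, so each piece
  -- is the image of a single compact set.
  let J := Σ (l : Fin (m + 1)) (n : Fin (m + 1)), (⦋l.1⦌ ⟶ ⦋m⦌) × (⦋l.1⦌ ⟶ ⦋n.1⦌)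
  let A : J → Set (_root_.stdSimplex ℝ (Fin (m + 1))) := fun j =>
    {b | Epi j.2.2.2 ∧ ∃ s : X _⦋j.2.1.1⦌, X.map j.2.2.1.op t = X.map j.2.2.2.op s ∧
      ∃ c, simplexMap j.2.2.1 c = b ∧ simplexMap j.2.2.2 c ∈ D _ s}
  have hA : ∀ j, IsClosed (A j) := by
    rintro ⟨l, n, i, e⟩
    by_cases he : Epi e
    · by_cases hs : ∃ s : X _⦋n.1⦌, X.map i.op t = X.map e.op s
      · obtain ⟨s, hs⟩ := hs
        have : A ⟨l, n, i, e⟩ = simplexMap i '' (simplexMap e ⁻¹' D _ s) := by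
          ext b
          constructor
          · rintro ⟨_, s', hs', c, hc, hc'⟩
            obtain rfl : s = s' := map_injective_of_epi e (hs.symm.trans hs')
            exact ⟨c, hc', hc⟩
          · rintro ⟨c, hc', hc⟩
            exact ⟨he, s, hs, c, hc, hc'⟩
        rw [this]
        exact (((hD _ s).preimage (simplexMap e).continuous).isCompact.image
          (simplexMap i).continuous).isClosed
      · convert isClosed_empty
        ext b
        simp only [Set.mem_empty_iff_false, iff_false]
        rintro ⟨_, s, h, _⟩
        exact hs ⟨s, h⟩
    · convert isClosed_empty
      ext b
      simp only [Set.mem_empty_iff_false, iff_false]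
      rintro ⟨h, _⟩
      exact he h
  have : charMap t ⁻¹' C = ⋃ j, A j := by
    ext b
    rw [Set.mem_iUnion]
    constructor
    · intro hb
      obtain ⟨n, s, a, hs, ha, h⟩ := exists_normalForm (charMap t b)
      obtain ⟨l, i, e, c, hi, he, hc, hc', hst⟩ := exists_of_charMap_eq hs ha h.symm
      have h1 : l ≤ m := SimplexCategory.len_le_of_mono i
      have h2 : n ≤ l := SimplexCategory.len_le_of_epi e
      refine ⟨⟨⟨l, by omega⟩, ⟨n, by omega⟩, i, e⟩, he, s, hst, c, hc, ?_⟩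
      rw [hc']
      exact hCD n s a hs ha (h ▸ hb)
    · rintro ⟨⟨l, n, i, e⟩, he, s, hst, c, rfl, hc'⟩
      have := hDC _ _ _ hc'
      dsimp only at *
      rwa [← charMap_map_apply, ← hst, charMap_map_apply] at this
  rw [this]
  exact isClosed_iUnion_of_finite hA

variable (X) in
/-- The union of all simplices of dimension less than `n` in the realization. -/
def skel (n : ℕ) : Set (SSet.toTop.obj X) :=
  {x | ∃ (k : ℕ) (s : X _⦋k⦌) (a : _root_.stdSimplex ℝ (Fin (k + 1))), k < n ∧ charMap s a = x}

lemma dim_lt_of_mem_skel {n k : ℕ} {s : X _⦋k⦌} (hs : s ∈ X.nonDegenerate k)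
    {a : _root_.stdSimplex ℝ (Fin (k + 1))} (ha : ∀ i, 0 < a i) (h : charMap s a ∈ skel X n) :
    k < n := by
  obtain ⟨m, t, b, hm, h⟩ := h
  obtain ⟨l, i, e, c, hi, he, -⟩ := exists_of_charMap_eq hs ha h
  have h1 : l ≤ m := SimplexCategory.len_le_of_mono i
  have h2 : k ≤ l := SimplexCategory.len_le_of_epi e
  omega

lemma charMap_mem_skel_of_boundary {n : ℕ} (s : X _⦋n⦌)
    {a : _root_.stdSimplex ℝ (Fin (n + 1))} (ha : ¬ ∀ i, 0 < a i) : charMap s a ∈ skel X n := by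
  obtain ⟨k, f, hf, b, hb, rfl⟩ := exists_interior_face a
  refine ⟨k, X.map f.op s, b, ?_, charMap_map_apply f s b⟩
  refine lt_of_le_of_ne (SimplexCategory.len_le_of_mono f) ?_
  rintro rfl
  obtain rfl := SimplexCategory.eq_id_of_mono f
  rw [simplexMap_id] at ha
  exact ha hb

/-- Normal forms of points of `skel X n` have dimension below `n`, so closedness of preimages need
only be tested there. -/
lemma continuousOn_skel {Z : Type*} [TopologicalSpace Z] {n : ℕ} {f : SSet.toTop.obj X → Z}
    (hf : ∀ (k : ℕ) (s : X _⦋k⦌), k < n → Continuous (f ∘ charMap s)) :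
    ContinuousOn f (skel X n) := by
  rw [continuousOn_iff_isClosed]
  intro K hK
  refine ⟨f ⁻¹' K ∩ skel X n, ?_, by rw [Set.inter_assoc, Set.inter_self]⟩
  refine isClosed_of_normalForm (fun k s => {a | k < n ∧ f (charMap s a) ∈ K}) ?_ ?_ ?_
  · intro k s
    by_cases hk : k < n
    · simp only [hk, true_and]
      exact hK.preimage (hf k s hk)
    · simp [hk]
  · rintro k s a ⟨hk, ha⟩
    exact ⟨ha, k, s, a, hk, rfl⟩
  · rintro k s a hs ha ⟨h1, h2⟩
    exact ⟨dim_lt_of_mem_skel hs ha h2, h1⟩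

/-- Extension of functions from the `n`-skeleton over the `n`-cells. -/
lemma exists_extension {Z : Type*} [TopologicalSpace Z] {n : ℕ} {f₀ : SSet.toTop.obj X → Z}
    (hf₀ : ∀ (k : ℕ) (s : X _⦋k⦌), k < n → Continuous (f₀ ∘ charMap s))
    (g : X _⦋n⦌ → C(_root_.stdSimplex ℝ (Fin (n + 1)), Z))
    (hg : ∀ s a, (¬ ∀ i, 0 < a i) → g s a = f₀ (charMap s a)) :
    ∃ f : SSet.toTop.obj X → Z, ContinuousOn f (skel X (n + 1)) ∧
      (∀ x ∈ skel X n, f x = f₀ x) ∧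
      ∀ s ∈ X.nonDegenerate n, ∀ a, f (charMap s a) = g s a := by
  classical
  -- Uniqueness of normal forms makes the chosen pair irrelevant.
  let f : SSet.toTop.obj X → Z := fun x =>
    if h : ∃ p : X _⦋n⦌ × _root_.stdSimplex ℝ (Fin (n + 1)), p.1 ∈ X.nonDegenerate n ∧
        (∀ i, 0 < p.2 i) ∧ charMap p.1 p.2 = x then g h.choose.1 h.choose.2 else f₀ x
  have h1 : ∀ x ∈ skel X n, f x = f₀ x := by
    intro x hx
    refine dif_neg ?_
    rintro ⟨⟨s, a⟩, hs, ha, rfl⟩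
    exact lt_irrefl _ (dim_lt_of_mem_skel hs ha hx)
  have h2 : ∀ s ∈ X.nonDegenerate n, ∀ a, f (charMap s a) = g s a := by
    intro s hs a
    by_cases ha : ∀ i, 0 < a i
    · have h : ∃ p : X _⦋n⦌ × _root_.stdSimplex ℝ (Fin (n + 1)), p.1 ∈ X.nonDegenerate n ∧
        (∀ i, 0 < p.2 i) ∧ charMap p.1 p.2 = charMap s a := ⟨⟨s, a⟩, hs, ha, rfl⟩
      have e : f (charMap s a) = g h.choose.1 h.choose.2 := dif_pos h
      have := normalForm_unique h.choose_spec.1 hs h.choose_spec.2.1 ha h.choose_spec.2.2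
      simp only [Sigma.mk.injEq, heq_eq_eq, true_and] at this
      rw [e]
      exact congrArg (fun p : X _⦋n⦌ × _root_.stdSimplex ℝ (Fin (n + 1)) => g p.1 p.2) this
    · rw [h1 _ (charMap_mem_skel_of_boundary s ha), hg s a ha]
  refine ⟨f, continuousOn_skel fun k s hk => ?_, h1, h2⟩
  have key : ∀ (k : ℕ) (s : X _⦋k⦌), k < n → Continuous (f ∘ charMap s) := by
    intro k s hk
    have : f ∘ charMap s = f₀ ∘ charMap s := by
      ext a
      exact h1 _ ⟨k, s, a, hk, rfl⟩
    rw [this]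
    exact hf₀ k s hk
  rcases (Nat.lt_succ_iff_lt_or_eq.1 hk) with hk | rfl
  · exact key k s hk
  · by_cases hs : s ∈ X.nonDegenerate k
    · have : f ∘ charMap s = g s := by
        ext a
        exact h2 s hs a
      rw [this]
      exact (g s).continuous
    -- A degenerate simplex factors through one of lower dimension, where continuity is already
    -- known.
    · rw [← mem_degenerate_iff_notMem_nonDegenerate] at hs
      obtain ⟨l, hl, e, t, rfl⟩ := hs
      rw [charMap_map]
      exact (key l t hl).comp (simplexMap e).continuous

end SSet
end

/-! ### Radial self-maps of the simplex fixing the boundary. -/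

section

open CategoryTheory Opposite Simplicial unitInterval

namespace stdSimplex

variable {n : ℕ}

lemma continuous_coord (i : Fin (n + 1)) :
    Continuous fun a : _root_.stdSimplex ℝ (Fin (n + 1)) => a.1 i :=
  (continuous_apply i).comp continuous_subtype_val

/-- The straight line homotopy from the identity to `Φ`. -/
noncomputable def lineHomotopy
    (Φ : C(_root_.stdSimplex ℝ (Fin (n + 1)), _root_.stdSimplex ℝ (Fin (n + 1)))) :
    C(_root_.stdSimplex ℝ (Fin (n + 1)) × I, _root_.stdSimplex ℝ (Fin (n + 1))) where
  toFun p := ⟨fun i => (1 - (p.2 : ℝ)) * p.1.1 i + p.2 * (Φ p.1).1 i, by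
    have := convex_stdSimplex ℝ (Fin (n + 1)) p.1.2 (Φ p.1).2 (sub_nonneg.2 p.2.2.2) p.2.2.1
      (by ring)
    exact this⟩
  continuous_toFun := by
    refine Continuous.subtype_mk (continuous_pi fun i => ?_) _
    have h1 := (continuous_coord i).comp (continuous_fst (X := _root_.stdSimplex ℝ (Fin (n + 1)))
      (Y := I))
    have h2 := (continuous_coord i).comp (Φ.continuous.comp
      (continuous_fst (X := _root_.stdSimplex ℝ (Fin (n + 1))) (Y := I)))
    have h3 := continuous_subtype_val.comp
      (continuous_snd (X := _root_.stdSimplex ℝ (Fin (n + 1))) (Y := I))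
    exact ((continuous_const.sub h3).mul h1).add (h3.mul h2)

lemma lineHomotopy_zero (Φ : C(_root_.stdSimplex ℝ (Fin (n + 1)), _root_.stdSimplex ℝ (Fin (n + 1))))
    (a : _root_.stdSimplex ℝ (Fin (n + 1))) : lineHomotopy Φ (a, 0) = a := by
  apply Subtype.ext
  funext i
  simp [lineHomotopy]

lemma lineHomotopy_one (Φ : C(_root_.stdSimplex ℝ (Fin (n + 1)), _root_.stdSimplex ℝ (Fin (n + 1))))
    (a : _root_.stdSimplex ℝ (Fin (n + 1))) : lineHomotopy Φ (a, 1) = Φ a := by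
  apply Subtype.ext
  funext i
  simp [lineHomotopy]

lemma lineHomotopy_of_fixed
    (Φ : C(_root_.stdSimplex ℝ (Fin (n + 1)), _root_.stdSimplex ℝ (Fin (n + 1))))
    {a : _root_.stdSimplex ℝ (Fin (n + 1))} (h : Φ a = a) (t : I) : lineHomotopy Φ (a, t) = a := by
  apply Subtype.ext
  funext i
  simp only [lineHomotopy, ContinuousMap.coe_mk, h]
  ring

/-- The minimal barycentric coordinate. -/
noncomputable def minCoord (a : _root_.stdSimplex ℝ (Fin (n + 1))) : ℝ :=
  Finset.univ.inf' Finset.univ_nonempty a.1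

lemma minCoord_le (a : _root_.stdSimplex ℝ (Fin (n + 1))) (i : Fin (n + 1)) :
    minCoord a ≤ a.1 i := Finset.inf'_le _ (Finset.mem_univ i)

lemma minCoord_nonneg (a : _root_.stdSimplex ℝ (Fin (n + 1))) : 0 ≤ minCoord a :=
  Finset.le_inf' _ _ fun i _ => a.2.1 i

lemma exists_minCoord (a : _root_.stdSimplex ℝ (Fin (n + 1))) : ∃ i, minCoord a = a.1 i := by
  obtain ⟨i, -, h⟩ := Finset.exists_mem_eq_inf' Finset.univ_nonempty a.1
  exact ⟨i, h⟩

lemma continuous_minCoord : Continuous (minCoord (n := n)) := by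
  unfold minCoord
  exact Continuous.finset_inf'_apply _ fun i _ => continuous_coord i

/-- The normalized distance to the boundary, which is `1` at the barycenter. -/
noncomputable def depth (a : _root_.stdSimplex ℝ (Fin (n + 1))) : ℝ := (n + 1) * minCoord a

lemma continuous_depth : Continuous (depth (n := n)) := continuous_const.mul continuous_minCoord

lemma depth_nonneg (a : _root_.stdSimplex ℝ (Fin (n + 1))) : 0 ≤ depth a :=
  mul_nonneg (by positivity) (minCoord_nonneg a)

lemma depth_le_one (a : _root_.stdSimplex ℝ (Fin (n + 1))) : depth a ≤ 1 := by
  have h : ∑ _i : Fin (n + 1), minCoord a ≤ ∑ i, a.1 i :=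
    Finset.sum_le_sum fun i _ => minCoord_le a i
  rw [a.2.2] at h
  simpa [depth] using h

lemma minCoord_eq_zero {a : _root_.stdSimplex ℝ (Fin (n + 1))} (h : ¬ ∀ i, 0 < a i) :
    minCoord a = 0 := by
  push Not at h
  obtain ⟨i, hi⟩ := h
  exact le_antisymm ((minCoord_le a i).trans hi) (minCoord_nonneg a)

/-- Radial rescaling around the barycenter, with a factor depending on the depth. -/
noncomputable def radial (r : C(ℝ, ℝ)) (h0 : ∀ t, 0 ≤ r t)
    (h1 : ∀ t, 0 ≤ t → t ≤ 1 → r t * (1 - t) ≤ 1) :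
    C(_root_.stdSimplex ℝ (Fin (n + 1)), _root_.stdSimplex ℝ (Fin (n + 1))) where
  -- The numbers `a i - minCoord a` sum to `1 - depth a`; the first summand spreads the remaining
  -- mass evenly. The image has depth `1 - r (1 - depth a)`, whence the condition `h1`.
  toFun a := ⟨fun i => (1 - r (depth a) * (1 - depth a)) / (n + 1) +
      r (depth a) * (a.1 i - minCoord a), by
    constructor
    · intro i
      have h2 := h1 _ (depth_nonneg a) (depth_le_one a)
      have h3 := minCoord_le a i
      have h4 := h0 (depth a)
      have : 0 ≤ (1 - r (depth a) * (1 - depth a)) / ((n : ℝ) + 1) :=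
        div_nonneg (by linarith) (by positivity)
      have := mul_nonneg h4 (sub_nonneg.2 h3)
      linarith
    · rw [Finset.sum_add_distrib, ← Finset.mul_sum, Finset.sum_sub_distrib, a.2.2]
      simp only [Finset.sum_const, Finset.card_univ, Fintype.card_fin, nsmul_eq_mul]
      push_cast
      rw [mul_div_cancel₀ _ (by positivity)]
      unfold depth
      ring⟩
  continuous_toFun := by
    have h2 := continuous_depth (n := n)
    have h3 := continuous_minCoord (n := n)
    have h4 := r.continuous.comp h2
    refine Continuous.subtype_mk (continuous_pi fun i => ?_) _
    exact ((continuous_const.sub (h4.mul (continuous_const.sub h2))).div_const _).add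
      (h4.mul ((continuous_coord i).sub h3))

lemma radial_apply (r : C(ℝ, ℝ)) (h0 : ∀ t, 0 ≤ r t)
    (h1 : ∀ t, 0 ≤ t → t ≤ 1 → r t * (1 - t) ≤ 1) (a : _root_.stdSimplex ℝ (Fin (n + 1)))
    (i : Fin (n + 1)) : radial r h0 h1 a i = (1 - r (depth a) * (1 - depth a)) / (n + 1) +
      r (depth a) * (a.1 i - minCoord a) := rfl

lemma radial_of_boundary (r : C(ℝ, ℝ)) (h0 : ∀ t, 0 ≤ r t)
    (h1 : ∀ t, 0 ≤ t → t ≤ 1 → r t * (1 - t) ≤ 1) (hr : r 0 = 1)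
    {a : _root_.stdSimplex ℝ (Fin (n + 1))} (h : ¬ ∀ i, 0 < a i) : radial r h0 h1 a = a := by
  ext i
  rw [radial_apply, depth, minCoord_eq_zero h]
  simp [hr]
  rfl

/-- Pushing points of small depth radially to the boundary. -/
lemma exists_expand : ∃ Φ : C(_root_.stdSimplex ℝ (Fin (n + 1)), _root_.stdSimplex ℝ (Fin (n + 1))),
    (∀ a, (¬ ∀ i, 0 < a i) → Φ a = a) ∧ ∀ a, depth a < 1 / 2 → ¬ ∀ i, 0 < Φ a i := by
  -- For `t ≤ 1/2` this is `1 / (1 - t)`, which makes the new depth zero; the maximum avoids the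
  -- pole at `t = 1`.
  let r : C(ℝ, ℝ) := ⟨fun t => (max (1 - t) (1 / 2))⁻¹, by
    refine Continuous.inv₀ (by fun_prop) fun t => ?_
    have : (1 / 2 : ℝ) ≤ max (1 - t) (1 / 2) := le_max_right _ _
    linarith⟩
  have hpos : ∀ t : ℝ, 0 < max (1 - t) (1 / 2) := fun t =>
    lt_of_lt_of_le (by norm_num) (le_max_right _ _)
  have h0 : ∀ t, 0 ≤ r t := fun t => inv_nonneg.2 (hpos t).le
  have h1 : ∀ t, 0 ≤ t → t ≤ 1 → r t * (1 - t) ≤ 1 := by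
    intro t _ _
    show (max (1 - t) (1 / 2))⁻¹ * (1 - t) ≤ 1
    rw [inv_mul_le_iff₀ (hpos t), mul_one]
    exact le_max_left _ _
  refine ⟨radial r h0 h1, fun a ha => radial_of_boundary r h0 h1 ?_ ha, fun a ha hall => ?_⟩
  · show (max (1 - (0 : ℝ)) (1 / 2))⁻¹ = 1
    norm_num
  · obtain ⟨i, hi⟩ := exists_minCoord a
    have h2 := hall i
    rw [radial_apply, ← hi, sub_self, mul_zero, add_zero] at h2
    have h3 : r (depth a) * (1 - depth a) = 1 := by
      show (max (1 - depth a) (1 / 2))⁻¹ * (1 - depth a) = 1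
      rw [max_eq_left (by linarith)]
      exact inv_mul_cancel₀ (by linarith)
    rw [h3] at h2
    simp at h2

/-- Collapsing the points of large depth to the barycenter. -/
lemma exists_collapse :
    ∃ (Φ : C(_root_.stdSimplex ℝ (Fin (n + 1)), _root_.stdSimplex ℝ (Fin (n + 1))))
      (b : _root_.stdSimplex ℝ (Fin (n + 1))),
    (∀ a, (¬ ∀ i, 0 < a i) → Φ a = a) ∧ ∀ a, 1 / 4 < depth a → Φ a = b := by
  -- The factor vanishes for `t ≥ 1/4`. As this threshold is below the `1/2` of the expansion, the
  -- two regions overlap.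
  let r : C(ℝ, ℝ) := ⟨fun t => max (1 - 4 * t) 0, by fun_prop⟩
  have h0 : ∀ t, 0 ≤ r t := fun t => le_max_right _ _
  have h1 : ∀ t, 0 ≤ t → t ≤ 1 → r t * (1 - t) ≤ 1 := by
    intro t h h'
    have : r t ≤ 1 := max_le (by linarith) zero_le_one
    nlinarith [h0 t]
  refine ⟨radial r h0 h1, ⟨fun _ => 1 / ((n : ℝ) + 1), fun i => by positivity, ?_⟩,
    fun a ha => radial_of_boundary r h0 h1 ?_ ha, fun a ha => ?_⟩
  · simp
    field_simp
  · show max (1 - 4 * (0 : ℝ)) 0 = 1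
    norm_num
  · ext i
    rw [radial_apply]
    have : r (depth a) = 0 := max_eq_right (by linarith)
    rw [this]
    simp
    rfl

end stdSimplex
end

/-! ### Every path is a concatenation of paths inside simplices. -/

section

open CategoryTheory Opposite Simplicial unitInterval

namespace SSet

variable {X : SSet.{u}}

lemma mem_skel_succ_iff {n : ℕ} {x : SSet.toTop.obj X} : x ∈ skel X (n + 1) ↔
    x ∈ skel X n ∨ ∃ s ∈ X.nonDegenerate n, ∃ a : _root_.stdSimplex ℝ (Fin (n + 1)),
      charMap s a = x := by
  constructor
  · intro hx
    obtain ⟨k, s, a, hs, ha, rfl⟩ := exists_normalForm x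
    rcases Nat.lt_succ_iff_lt_or_eq.1 (dim_lt_of_mem_skel hs ha hx) with hk | rfl
    · exact Or.inl ⟨k, s, a, hk, rfl⟩
    · exact Or.inr ⟨s, hs, a, rfl⟩
  · rintro (⟨k, s, a, hk, rfl⟩ | ⟨s, -, a, rfl⟩)
    · exact ⟨k, s, a, hk.trans (Nat.lt_succ_self n), rfl⟩
    · exact ⟨n, s, a, Nat.lt_succ_self n, rfl⟩

/-- A self-map of the simplex fixing the boundary induces a deformation of the skeleton. -/
lemma exists_deformation {n : ℕ}
    {Φ : C(_root_.stdSimplex ℝ (Fin (n + 1)), _root_.stdSimplex ℝ (Fin (n + 1)))}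
    (hΦ : ∀ a, (¬ ∀ i, 0 < a i) → Φ a = a) :
    ∃ h : SSet.toTop.obj X → C(I, SSet.toTop.obj X), ContinuousOn h (skel X (n + 1)) ∧
      (∀ x ∈ skel X n, ∀ t, h x t = x) ∧
      ∀ s ∈ X.nonDegenerate n, ∀ a t,
        h (charMap s a) t = charMap s (_root_.stdSimplex.lineHomotopy Φ (a, t)) := by
  obtain ⟨h, h1, h2, h3⟩ := exists_extension (X := X) (n := n)
    (f₀ := fun x => ContinuousMap.const I x)
    (fun k s _ => ContinuousMap.continuous_const'.comp (charMap s).continuous)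
    (fun s => ((charMap s).comp (_root_.stdSimplex.lineHomotopy Φ)).curry)
    (fun s a ha => by
      ext t
      simp [_root_.stdSimplex.lineHomotopy_of_fixed Φ (hΦ a ha)])
  refine ⟨h, h1, fun x hx t => ?_, fun s hs a t => ?_⟩
  · rw [h2 x hx]; rfl
  · rw [h3 s hs a]; rfl

/-- A continuous function on the skeleton that measures the depth in the `n`-cells from a given
set. -/
lemma exists_depth (n : ℕ) (A : Set (X _⦋n⦌)) :
    ∃ μ : SSet.toTop.obj X → ℝ, ContinuousOn μ (skel X (n + 1)) ∧ (∀ x ∈ skel X n, μ x = 0) ∧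
      (∀ s ∈ X.nonDegenerate n, s ∈ A → ∀ a, μ (charMap s a) = _root_.stdSimplex.depth a) ∧
      (∀ s ∈ X.nonDegenerate n, s ∉ A → ∀ a, μ (charMap s a) = 0) := by
  classical
  obtain ⟨h, h1, h2, h3⟩ := exists_extension (X := X) (n := n) (f₀ := fun _ => (0 : ℝ))
    (fun k s _ => continuous_const)
    (fun s => if s ∈ A then ⟨_, _root_.stdSimplex.continuous_depth⟩ else ContinuousMap.const _ 0)
    (fun s a ha => by
      split_ifs
      · simp [_root_.stdSimplex.depth, _root_.stdSimplex.minCoord_eq_zero ha]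
      · rfl)
  refine ⟨h, h1, h2, fun s hs hA a => ?_, fun s hs hA a => ?_⟩
  · rw [h3 s hs a, if_pos hA]; rfl
  · rw [h3 s hs a, if_neg hA]; rfl

variable {T : ∀ y y' : SSet.toTop.obj X, Path.Homotopic.Quotient y y' → Prop}

/-- Each point moves inside a single simplex or stays fixed, so the endpoint tracks of the homotopy
belong to `T` by `hs`. -/
lemma class_of_deformation (hT : Path.TransClosed T)
    (hs : ∀ (n : ℕ) (s : X _⦋n⦌) (q : C(I, _root_.stdSimplex ℝ (Fin (n + 1)))),
      T _ _ (.mk (((charMap s).comp q).toPath)))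
    {n : ℕ} {Φ : C(_root_.stdSimplex ℝ (Fin (n + 1)), _root_.stdSimplex ℝ (Fin (n + 1)))}
    {h : SSet.toTop.obj X → C(I, SSet.toTop.obj X)} (h1 : ContinuousOn h (skel X (n + 1)))
    (h2 : ∀ x ∈ skel X n, ∀ t, h x t = x)
    (h3 : ∀ s ∈ X.nonDegenerate n, ∀ a t,
        h (charMap s a) t = charMap s (_root_.stdSimplex.lineHomotopy Φ (a, t)))
    {f g : C(I, SSet.toTop.obj X)} (hf : ∀ t, f t ∈ skel X (n + 1)) (hg : ∀ t, h (f t) 1 = g t)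
    (hgT : T _ _ (.mk g.toPath)) : T _ _ (.mk f.toPath) := by
  have hcont : Continuous fun t => h (f t) := h1.comp_continuous f.continuous hf
  have hzero : ∀ x ∈ skel X (n + 1), h x 0 = x := by
    intro x hx
    rcases mem_skel_succ_iff.1 hx with hx | ⟨s, hsn, a, rfl⟩
    · exact h2 x hx 0
    · rw [h3 s hsn a 0, _root_.stdSimplex.lineHomotopy_zero]
  have htrack : ∀ x ∈ skel X (n + 1), ∃ (k : ℕ) (s : X _⦋k⦌)
      (q : C(I, _root_.stdSimplex ℝ (Fin (k + 1)))), ∀ t, h x t = charMap s (q t) := by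
    intro x hx
    rcases mem_skel_succ_iff.1 hx with hx' | ⟨s, hsn, a, rfl⟩
    · obtain ⟨k, s, a, -, rfl⟩ := id hx'
      exact ⟨k, s, ContinuousMap.const _ a, fun t => h2 _ hx' t⟩
    · exact ⟨n, s, ⟨fun t => _root_.stdSimplex.lineHomotopy Φ (a, t), by fun_prop⟩,
        fun t => h3 s hsn a t⟩
  let H : f.Homotopy g :=
    { toFun := fun p => h (f p.2) p.1
      continuous_toFun := by
        have := ContinuousMap.continuous_uncurry_of_continuous ⟨fun t => h (f t), hcont⟩
        exact this.comp continuous_swap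
      map_zero_left := fun t => hzero _ (hf t)
      map_one_left := hg }
  have hev : ∀ t : I, T _ _ (.mk (H.evalAt t)) ∧ T _ _ (.mk (H.evalAt t).symm) := by
    intro t
    obtain ⟨k, s, q, hq⟩ := htrack (f t) (hf t)
    constructor
    · refine (Path.class_mk_iff (T := T) _).2 ?_
      have : ((H.evalAt t : _root_.Path _ _) : C(I, SSet.toTop.obj X)) = (charMap s).comp q := by
        ext r
        exact hq r
      rw [this]
      exact hs k s q
    · refine (Path.class_mk_iff (T := T) _).2 ?_
      have : (((H.evalAt t).symm : _root_.Path _ _) : C(I, SSet.toTop.obj X)) =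
          (charMap s).comp (q.comp ⟨σ, unitInterval.continuous_symm⟩) := by
        ext r
        exact hq (σ r)
      rw [this]
      exact hs k s _
  exact hT.of_homotopy H (hev 0).1 (hev 1).2 hgT

lemma class_of_skel (hT : Path.TransClosed T)
    (hs : ∀ (n : ℕ) (s : X _⦋n⦌) (q : C(I, _root_.stdSimplex ℝ (Fin (n + 1)))),
      T _ _ (.mk (((charMap s).comp q).toPath)))
    (n : ℕ) (f : C(I, SSet.toTop.obj X)) (hf : ∀ t, f t ∈ skel X n) : T _ _ (.mk f.toPath) := by
  induction n generalizing f with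
  | zero =>
    obtain ⟨k, s, a, hk, -⟩ := hf 0
    exact absurd hk (Nat.not_lt_zero k)
  | succ n ih =>
    obtain ⟨μ, μ1, μ2, μ3, -⟩ := exists_depth (X := X) n Set.univ
    choose ν ν1 ν2 ν3 ν4 using fun s : X _⦋n⦌ => exists_depth (X := X) n {s}
    -- On the part near the lower skeleton the path expands into `skel X n` and the induction
    -- hypothesis applies. On the part deep inside one cell it collapses to a constant path at the
    -- barycenter.
    let c : Option (X _⦋n⦌) → Set I := fun o =>
      match o with
      | none => {t | μ (f t) < 1 / 2}
      | some s => {t | s ∈ X.nonDegenerate n ∧ 1 / 4 < ν s (f t)}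
    have hc : ∀ o, IsOpen (c o) := by
      rintro (_ | s)
      · exact isOpen_lt (μ1.comp_continuous f.continuous hf) continuous_const
      · by_cases hs : s ∈ X.nonDegenerate n
        · simp only [c, hs, true_and]
          exact isOpen_lt continuous_const ((ν1 s).comp_continuous f.continuous hf)
        · simp [c, hs]
    have hcov : Set.univ ⊆ ⋃ o, c o := by
      intro t _
      rw [Set.mem_iUnion]
      rcases mem_skel_succ_iff.1 (hf t) with hx | ⟨s, hsn, a, ha⟩
      · refine ⟨none, ?_⟩
        show μ (f t) < 1 / 2
        rw [μ2 _ hx]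
        norm_num
      · by_cases hd : _root_.stdSimplex.depth a < 1 / 2
        · refine ⟨none, ?_⟩
          show μ (f t) < 1 / 2
          rwa [← ha, μ3 s hsn trivial]
        · refine ⟨some s, hsn, ?_⟩
          rw [← ha, ν3 s s hsn rfl]
          linarith
    refine hT.of_cover f hc hcov fun o g hg => ?_
    have hfg : ∀ t, (f.comp g) t ∈ skel X (n + 1) := fun t => hf (g t)
    rcases o with _ | s
    · obtain ⟨Φ, hΦ1, hΦ2⟩ := _root_.stdSimplex.exists_expand (n := n)
      obtain ⟨h, h1, h2, h3⟩ := exists_deformation (X := X) hΦ1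
      have hcont : Continuous fun t => h (f (g t)) := h1.comp_continuous (f.comp g).continuous hfg
      refine class_of_deformation hT hs h1 h2 h3 (g := ⟨fun t => h (f (g t)) 1,
        (continuous_eval_const (1 : I)).comp hcont⟩) hfg (fun t => rfl) (ih _ fun t => ?_)
      have hμ : μ (f (g t)) < 1 / 2 := hg t
      show h (f (g t)) 1 ∈ skel X n
      rcases mem_skel_succ_iff.1 (hfg t) with hx | ⟨s, hsn, a, ha⟩
      · have hx' : f (g t) ∈ skel X n := hx
        rw [h2 _ hx']
        exact hx'
      · have ha' : charMap s a = f (g t) := ha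
        rw [← ha', h3 s hsn, _root_.stdSimplex.lineHomotopy_one]
        rw [← ha', μ3 s hsn trivial] at hμ
        exact charMap_mem_skel_of_boundary s (hΦ2 a hμ)
    · obtain ⟨Φ, b, hΦ1, hΦ2⟩ := _root_.stdSimplex.exists_collapse (n := n)
      obtain ⟨h, h1, h2, h3⟩ := exists_deformation (X := X) hΦ1
      refine class_of_deformation hT hs h1 h2 h3
        (g := (charMap s).comp (ContinuousMap.const I b)) hfg (fun t => ?_) (hs n s _)
      obtain ⟨hsn, hν⟩ : s ∈ X.nonDegenerate n ∧ 1 / 4 < ν s (f (g t)) := hg t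
      show h (f (g t)) 1 = charMap s b
      rcases mem_skel_succ_iff.1 (hfg t) with hx | ⟨s', hsn', a, ha⟩
      · have hx' : f (g t) ∈ skel X n := hx
        rw [ν2 s _ hx'] at hν
        norm_num at hν
      · have ha' : charMap s' a = f (g t) := ha
        by_cases e : s' = s
        · subst e
          rw [← ha', h3 s' hsn, _root_.stdSimplex.lineHomotopy_one, hΦ2 a]
          rwa [← ha', ν3 s' s' hsn rfl] at hν
        · rw [← ha', ν4 s s' hsn' e] at hν
          norm_num at hν

/-- A compact subset of the realization lies in a skeleton. -/
lemma exists_skel_of_isCompact {K : Set (SSet.toTop.obj X)} (hK : IsCompact K) :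
    ∃ n, K ⊆ skel X n := by
  by_contra! hcon
  have hmono : ∀ {m n : ℕ}, m ≤ n → skel X m ⊆ skel X n := by
    rintro m n hmn x ⟨k, s, a, hk, rfl⟩
    exact ⟨k, s, a, hk.trans_le hmn, rfl⟩
  have hex : ∀ n : ℕ, ∃ p : Σ k : ℕ, X _⦋k⦌ × _root_.stdSimplex ℝ (Fin (k + 1)), n ≤ p.1 ∧
      p.2.1 ∈ X.nonDegenerate p.1 ∧ (∀ i, 0 < p.2.2 i) ∧ charMap p.2.1 p.2.2 ∈ K := by
    intro n
    obtain ⟨x, hxK, hx⟩ := Set.not_subset.1 (hcon n)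
    obtain ⟨k, s, a, hs, ha, rfl⟩ := exists_normalForm x
    refine ⟨⟨k, s, a⟩, ?_, hs, ha, hxK⟩
    by_contra! hk
    exact hx ⟨k, s, a, hk, rfl⟩
  choose p hp1 hp2 hp3 hp4 using hex
  -- Selects points of `K` in the interiors of cells of strictly increasing dimension. Every set of
  -- them is closed, since it has at most one normal form in each simplex; the complements of the
  -- tails then contradict compactness.
  let φ : ℕ → ℕ := fun j => Nat.rec 0 (fun _ m => (p m).1 + 1) j
  have hφ : ∀ j, (p (φ j)).1 < (p (φ (j + 1))).1 := fun j => hp1 (φ (j + 1))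
  have hinj : StrictMono fun j => (p (φ j)).1 := strictMono_nat_of_lt_succ hφ
  let x : ℕ → SSet.toTop.obj X := fun j => charMap (p (φ j)).2.1 (p (φ j)).2.2
  let U : ℕ → Set (SSet.toTop.obj X) := fun N => (x '' Set.Ici N)ᶜ
  have hU : ∀ N, IsOpen (U N) := by
    intro N
    rw [isOpen_compl_iff]
    refine isClosed_of_normalForm (fun k s => {a | ∃ j, N ≤ j ∧ p (φ j) = ⟨k, s, a⟩}) ?_ ?_ ?_
    · intro k s
      refine Set.Subsingleton.isClosed ?_
      rintro a ⟨j, -, hj⟩ b ⟨j', -, hj'⟩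
      have : j = j' := hinj.injective (by simp [hj, hj'])
      subst this
      rw [hj] at hj'
      simpa using hj'
    · rintro k s a ⟨j, hNj, hj⟩
      refine ⟨j, hNj, ?_⟩
      show charMap (p (φ j)).2.1 (p (φ j)).2.2 = _
      rw [hj]
    · rintro k s a hs ha ⟨j, hNj, hj⟩
      exact ⟨j, hNj, normalForm_unique (hp2 _) hs (hp3 _) ha hj⟩
  have hxinj : Function.Injective x := by
    intro j j' h
    have := normalForm_unique (hp2 _) (hp2 _) (hp3 _) (hp3 _) h
    exact hinj.injective (congrArg Sigma.fst this)
  have hcov : K ⊆ ⋃ N, U N := by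
    intro y _
    rw [Set.mem_iUnion]
    by_contra! h
    have h0 := h 0
    simp only [U, Set.mem_compl_iff, not_not] at h h0
    obtain ⟨j, -, rfl⟩ := h0
    obtain ⟨j', hj', e⟩ := h (j + 1)
    have := hxinj e
    subst this
    exact absurd hj' (by simp)
  obtain ⟨N, hN⟩ := hK.elim_directed_cover U hU hcov (by
    refine Monotone.directed_le fun a b hab => ?_
    exact Set.compl_subset_compl.2 (Set.image_mono (Set.Ici_subset_Ici.2 hab)))
  exact hN (hp4 (φ N)) ⟨N, by simp, rfl⟩

/-- Every path in the realization is, up to homotopy, a concatenation of paths in simplices. -/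
theorem class_of_simplices (hT : Path.TransClosed T)
    (hs : ∀ (n : ℕ) (s : X _⦋n⦌) (q : C(I, _root_.stdSimplex ℝ (Fin (n + 1)))),
      T _ _ (.mk (((charMap s).comp q).toPath)))
    {x y : SSet.toTop.obj X} (p : Path.Homotopic.Quotient x y) : T x y p := by
  induction p using Path.Homotopic.Quotient.ind with | mk p =>
  obtain ⟨n, hn⟩ := exists_skel_of_isCompact (isCompact_range p.continuous)
  exact (Path.class_mk_iff (T := T) p).2
    (class_of_skel hT hs n (p : C(I, SSet.toTop.obj X)) fun t => hn ⟨t, rfl⟩)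

end SSet
end

/-! ### Paths between vertices are edge paths. -/

section

open CategoryTheory Opposite Simplicial unitInterval

namespace SSet

instance (n : ℕ) : SimplyConnectedSpace (_root_.stdSimplex ℝ (Fin (n + 1))) :=
  have : ContractibleSpace (_root_.stdSimplex ℝ (Fin (n + 1))) :=
    (convex_stdSimplex ℝ (Fin (n + 1))).contractibleSpace
      ⟨_, (_root_.stdSimplex.vertex (S := ℝ) (0 : Fin (n + 1))).2⟩
  inferInstance

section

variable {Y : Type u} [TopologicalSpace Y] {m n : ℕ}

/-- The image under `c` of the homotopy class of paths from `a` to `b` in the simplex. -/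
noncomputable def simplexPath (c : C(_root_.stdSimplex ℝ (Fin (n + 1)), Y))
    (a b : _root_.stdSimplex ℝ (Fin (n + 1))) : Path.Homotopic.Quotient (c a) (c b) :=
  (Path.Homotopic.Quotient.mk (PathConnectedSpace.somePath a b)).map c

lemma simplexPath_eq (c : C(_root_.stdSimplex ℝ (Fin (n + 1)), Y))
    {a b : _root_.stdSimplex ℝ (Fin (n + 1))} (p : Path.Homotopic.Quotient a b) :
    simplexPath c a b = p.map c := by
  rw [simplexPath, Subsingleton.elim (Path.Homotopic.Quotient.mk _) p]

lemma simplexPath_comp (c : C(_root_.stdSimplex ℝ (Fin (n + 1)), Y))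
    (g : C(_root_.stdSimplex ℝ (Fin (m + 1)), _root_.stdSimplex ℝ (Fin (n + 1))))
    (a b : _root_.stdSimplex ℝ (Fin (m + 1))) :
    simplexPath (c.comp g) a b = simplexPath c (g a) (g b) := by
  rw [simplexPath, Path.Homotopic.Quotient.map_comp, ← simplexPath_eq]

lemma simplexPath_trans (c : C(_root_.stdSimplex ℝ (Fin (n + 1)), Y))
    (a b d : _root_.stdSimplex ℝ (Fin (n + 1))) :
    (simplexPath c a b).trans (simplexPath c b d) = simplexPath c a d := by
  rw [simplexPath_eq c ((Path.Homotopic.Quotient.mk (PathConnectedSpace.somePath a b)).trans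
    (Path.Homotopic.Quotient.mk (PathConnectedSpace.somePath b d)))]
  rw [simplexPath, simplexPath, ← Path.Homotopic.Quotient.mk_trans,
    ← Path.Homotopic.Quotient.mk_map, ← Path.Homotopic.Quotient.mk_map,
    ← Path.Homotopic.Quotient.mk_map, ← Path.Homotopic.Quotient.mk_trans, Path.map_trans]

lemma simplexPath_self (c : C(_root_.stdSimplex ℝ (Fin (n + 1)), Y))
    (a : _root_.stdSimplex ℝ (Fin (n + 1))) : simplexPath c a a = .refl _ := by
  rw [simplexPath_eq c (.refl a)]
  rfl

lemma simplexPath_symm (c : C(_root_.stdSimplex ℝ (Fin (n + 1)), Y))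
    (a b : _root_.stdSimplex ℝ (Fin (n + 1))) :
    (simplexPath c a b).symm = simplexPath c b a := by
  rw [simplexPath_eq c (Path.Homotopic.Quotient.mk (PathConnectedSpace.somePath a b)).symm]
  rfl

lemma mk_toPath_comp (c : C(_root_.stdSimplex ℝ (Fin (n + 1)), Y))
    (q : C(I, _root_.stdSimplex ℝ (Fin (n + 1)))) :
    Path.Homotopic.Quotient.mk (c.comp q).toPath = simplexPath c (q 0) (q 1) := by
  rw [simplexPath_eq c (.mk q.toPath)]
  rfl

variable {x₀ : Y} (P : ∀ y : Y, Path.Homotopic.Quotient x₀ y → Prop)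

/-- The property `P` of paths is transported along the simplex path from `a` to `b`. -/
def Transports (c : C(_root_.stdSimplex ℝ (Fin (n + 1)), Y))
    (a b : _root_.stdSimplex ℝ (Fin (n + 1))) : Prop :=
  ∀ γ : Path.Homotopic.Quotient x₀ (c a), P _ γ → P _ (γ.trans (simplexPath c a b))

lemma transports_comp (c : C(_root_.stdSimplex ℝ (Fin (n + 1)), Y))
    (g : C(_root_.stdSimplex ℝ (Fin (m + 1)), _root_.stdSimplex ℝ (Fin (n + 1))))
    (a b : _root_.stdSimplex ℝ (Fin (m + 1))) :
    Transports P (c.comp g) a b ↔ Transports P c (g a) (g b) := by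
  unfold Transports
  rw [simplexPath_comp]
  rfl

/-- The paths ending at `c a` that satisfy `P` after continuing to the initial vertex. -/
def coneSet (c : C(_root_.stdSimplex ℝ (Fin (n + 1)), Y)) (a : _root_.stdSimplex ℝ (Fin (n + 1))) :
    Set (Σ y : Y, Path.Homotopic.Quotient x₀ y) :=
  {p | ∃ h : c a = p.1, P _ ((p.2.cast rfl h).trans
    (simplexPath c a (_root_.stdSimplex.vertex 0)))}

lemma mem_coneSet (c : C(_root_.stdSimplex ℝ (Fin (n + 1)), Y))
    (a : _root_.stdSimplex ℝ (Fin (n + 1))) (γ : Path.Homotopic.Quotient x₀ (c a)) :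
    ⟨c a, γ⟩ ∈ coneSet P c a ↔
      P _ (γ.trans (simplexPath c a (_root_.stdSimplex.vertex 0))) := by
  constructor
  · rintro ⟨h, hP⟩
    rwa [Path.Homotopic.Quotient.cast_rfl_rfl] at hP
  · intro hP
    refine ⟨rfl, ?_⟩
    rwa [Path.Homotopic.Quotient.cast_rfl_rfl]

/-- The initial vertex of a face may differ from that of the simplex; transport between these two
vertices makes the condition independent of which simplex is used. -/
lemma coneSet_comp {c : C(_root_.stdSimplex ℝ (Fin (n + 1)), Y)}
    {g : C(_root_.stdSimplex ℝ (Fin (m + 1)), _root_.stdSimplex ℝ (Fin (n + 1)))}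
    (h₁ : Transports P c (g (_root_.stdSimplex.vertex 0)) (_root_.stdSimplex.vertex 0))
    (h₂ : Transports P c (_root_.stdSimplex.vertex 0) (g (_root_.stdSimplex.vertex 0)))
    (a : _root_.stdSimplex ℝ (Fin (m + 1))) :
    coneSet P (c.comp g) a = coneSet P c (g a) := by
  ext ⟨y, γ⟩
  constructor
  · rintro ⟨hy, h⟩
    dsimp only at hy h
    subst hy
    refine (mem_coneSet P c (g a) γ).2 ?_
    rw [Path.Homotopic.Quotient.cast_rfl_rfl, simplexPath_comp] at h
    have := h₁ _ h
    rwa [Path.Homotopic.Quotient.trans_assoc, simplexPath_trans] at this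
  · rintro ⟨hy, h⟩
    dsimp only at hy h
    subst hy
    refine (mem_coneSet P (c.comp g) a γ).2 ?_
    rw [Path.Homotopic.Quotient.cast_rfl_rfl] at h
    have := h₂ _ h
    rw [Path.Homotopic.Quotient.trans_assoc, simplexPath_trans] at this
    rw [simplexPath_comp]
    exact this

end

variable {X : SSet.{u}}

/-- A property of paths starting at a vertex that is transported forward and backward along edges
holds for all paths between vertices. -/
theorem edge_path_induction (v w : X _⦋0⦌)
    (P : ∀ y : SSet.toTop.obj X,
      Path.Homotopic.Quotient (charMap v (_root_.stdSimplex.vertex 0)) y → Prop)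
    (h01 : ∀ e : X _⦋1⦌, Transports P (charMap e) (_root_.stdSimplex.vertex 0)
      (_root_.stdSimplex.vertex 1))
    (h10 : ∀ e : X _⦋1⦌, Transports P (charMap e) (_root_.stdSimplex.vertex 1)
      (_root_.stdSimplex.vertex 0))
    (hrefl : P _ (.refl _))
    (γ : Path.Homotopic.Quotient (charMap v (_root_.stdSimplex.vertex 0))
      (charMap w (_root_.stdSimplex.vertex 0))) : P _ γ := by
  -- Any two vertices of a simplex span an edge, degenerate if they coincide.
  have hvert : ∀ (n : ℕ) (s : X _⦋n⦌) (i j : Fin (n + 1)),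
      Transports P (charMap s) (_root_.stdSimplex.vertex i) (_root_.stdSimplex.vertex j) := by
    intro n s i j
    rcases le_total i j with h | h
    · have := h01 (X.map (SimplexCategory.mkOfLe i j h).op s)
      rw [charMap_map, transports_comp, simplexMap_vertex, simplexMap_vertex] at this
      exact this
    · have := h10 (X.map (SimplexCategory.mkOfLe j i h).op s)
      rw [charMap_map, transports_comp, simplexMap_vertex, simplexMap_vertex] at this
      exact this
  obtain ⟨F, hF⟩ := exists_desc_fun (X := X) (fun n s a => coneSet P (charMap s) a)
    (fun m n f s a => by
      rw [charMap_map]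
      refine coneSet_comp P ?_ ?_ a <;> rw [simplexMap_vertex] <;> exact hvert _ _ _ _)
  -- `F` extends `P` to paths ending anywhere, by continuing to a vertex inside a simplex. `T` says
  -- that appending `q` preserves `F`, so it is closed under concatenation, and it holds inside a
  -- simplex because all paths there with fixed ends are homotopic.
  let T : ∀ y y' : SSet.toTop.obj X, Path.Homotopic.Quotient y y' → Prop := fun y y' q =>
    ∀ δ : Path.Homotopic.Quotient (charMap v (_root_.stdSimplex.vertex 0)) y,
      ⟨y, δ⟩ ∈ F y → ⟨y', δ.trans q⟩ ∈ F y'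
  have hT : Path.TransClosed T := ⟨fun hp hq δ hδ => by
    rw [← Path.Homotopic.Quotient.trans_assoc]
    exact hq _ (hp δ hδ)⟩
  have hs : ∀ (n : ℕ) (s : X _⦋n⦌) (q : C(I, _root_.stdSimplex ℝ (Fin (n + 1)))),
      T _ _ (.mk (((charMap s).comp q).toPath)) := by
    intro n s q δ hδ
    have e0 : F (((charMap s).comp q) 0) = coneSet P (charMap s) (q 0) := hF n s (q 0)
    have e1 : F (((charMap s).comp q) 1) = coneSet P (charMap s) (q 1) := hF n s (q 1)
    rw [e0] at hδ
    rw [e1, mk_toPath_comp]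
    refine (mem_coneSet P (charMap s) (q 1) _).2 ?_
    rw [Path.Homotopic.Quotient.trans_assoc, simplexPath_trans]
    exact (mem_coneSet P (charMap s) (q 0) _).1 hδ
  have h1 := class_of_simplices hT hs γ (.refl _) (by
    rw [hF]
    refine (mem_coneSet P _ _ _).2 ?_
    rwa [simplexPath_self, Path.Homotopic.Quotient.trans_refl])
  rw [hF] at h1
  have h2 := (mem_coneSet P _ _ _).1 h1
  rwa [simplexPath_self, Path.Homotopic.Quotient.trans_refl,
    Path.Homotopic.Quotient.refl_trans] at h2

end SSet
end

/-! ### A covering with group G, built from functions on the interval. -/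

section

open CategoryTheory Opposite Simplicial unitInterval MeasureTheory

attribute [local instance] Measure.Subtype.measureSpace

/-- Functions on the half-open unit interval with values in `G`, with the topology of convergence
in measure for the discrete metric on `G`. -/
def StepFun (G : Type u) : Type u := Set.Ico (0 : ℝ) 1 → G

namespace StepFun

variable {G : Type u}

instance : IsProbabilityMeasure (volume : Measure (Set.Ico (0 : ℝ) 1)) :=
  ⟨by rw [Measure.Subtype.volume_univ measurableSet_Ico.nullMeasurableSet]; simp⟩

noncomputable instance : PseudoMetricSpace (StepFun G) where
  -- The functions are arbitrary; subadditivity holds for nonmeasurable sets too, so no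
  -- measurability is imposed.
  dist f g := (volume : Measure (Set.Ico (0 : ℝ) 1)).real {t | f t ≠ g t}
  dist_self f := by simp
  dist_comm f g := by simp only [ne_comm]
  dist_triangle f g h := by
    refine (measureReal_mono ?_).trans (measureReal_union_le _ _)
    intro t ht
    by_cases h1 : f t = g t
    · right
      exact fun h2 => ht (h1.trans h2)
    · exact Or.inl h1

lemma dist_def (f g : StepFun G) :
    dist f g = (volume : Measure (Set.Ico (0 : ℝ) 1)).real {t | f t ≠ g t} := rfl

variable [AddGroup G]

instance : AddAction G (StepFun G) where
  vadd g f := fun t => g + f t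
  zero_vadd f := funext fun t => zero_add (f t)
  add_vadd g h f := funext fun t => add_assoc g h (f t)

lemma vadd_apply (g : G) (f : StepFun G) (t : Set.Ico (0 : ℝ) 1) : (g +ᵥ f) t = g + f t := rfl

lemma dist_vadd_vadd (g : G) (f f' : StepFun G) : dist (g +ᵥ f) (g +ᵥ f') = dist f f' := by
  simp [dist_def, vadd_apply]

lemma dist_vadd_self {g : G} (hg : g ≠ 0) (f : StepFun G) : dist (g +ᵥ f) f = 1 := by
  have : {t | (g +ᵥ f) t ≠ f t} = Set.univ := by
    ext t
    simp [vadd_apply, hg]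
  rw [dist_def, this]
  simp

variable (G) in
/-- The orbit space of `StepFun G`, a classifying space for principal `G`-bundles. -/
def OrbitSpace : Type u := Quotient (AddAction.orbitRel G (StepFun G))

instance : TopologicalSpace (OrbitSpace G) :=
  inferInstanceAs (TopologicalSpace (Quotient (AddAction.orbitRel G (StepFun G))))

/-- The quotient map. -/
def toOrbit (f : StepFun G) : OrbitSpace G := Quotient.mk'' f

lemma toOrbit_eq_iff {f f' : StepFun G} : toOrbit f = toOrbit f' ↔ ∃ g : G, g +ᵥ f' = f :=
  Quotient.eq''

/-- The action is isometric and a nonzero element moves every function by distance 1, so a ball of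
radius 1/2 is disjoint from its other translates. -/
lemma isAddQuotientCoveringMap : IsAddQuotientCoveringMap (toOrbit (G := G)) G where
  toIsQuotientMap := isQuotientMap_quotient_mk'
  continuous_const_vadd g := (Isometry.of_dist_eq (dist_vadd_vadd g)).continuous
  apply_eq_iff_mem_orbit := Quotient.eq''
  disjoint f := by
    refine ⟨Metric.ball f (1 / 2), Metric.ball_mem_nhds f (by norm_num), fun g => ?_⟩
    rintro ⟨_, ⟨f', hf', rfl⟩, hf''⟩
    by_contra hg
    have h1 := dist_vadd_self hg f'
    have h2 : dist (g +ᵥ f') f < 1 / 2 := hf''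
    have h3 : dist f' f < 1 / 2 := hf'
    have h4 := dist_triangle_right (g +ᵥ f') f' f
    linarith

end StepFun

/-! ### Step functions attached to barycentric coordinates. -/

namespace stdSimplex

variable {n : ℕ}

/-- The partial sums of barycentric coordinates. -/
noncomputable def partialSum (a : _root_.stdSimplex ℝ (Fin (n + 1))) (i : Fin (n + 1)) : ℝ :=
  ∑ j with j ≤ i, a.1 j

lemma continuous_partialSum (i : Fin (n + 1)) :
    Continuous fun a : _root_.stdSimplex ℝ (Fin (n + 1)) => partialSum a i :=
  continuous_finsetSum _ fun j _ => continuous_coord j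

lemma exists_index (a : _root_.stdSimplex ℝ (Fin (n + 1))) (t : Set.Ico (0 : ℝ) 1) :
    ∃ i, t < partialSum a i ∧ ∀ j < i, partialSum a j ≤ t := by
  have hlast : t < partialSum a (Fin.last n) := by
    have : partialSum a (Fin.last n) = 1 := by
      unfold partialSum
      rw [Finset.filter_true_of_mem fun j _ => Fin.le_last j]
      exact a.2.2
    rw [this]
    exact t.2.2
  have hne : {i | (t : ℝ) < partialSum a i}.Nonempty := ⟨_, hlast⟩
  obtain ⟨i, hi⟩ := exists_minimal_of_wellFoundedLT (fun i => (t : ℝ) < partialSum a i) hne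
  exact ⟨i, hi.1, fun j hj => not_lt.1 fun h => (not_le.2 hj) (hi.2 h hj.le)⟩

/-- The index of the step containing `t`, in the subdivision of the interval given by `a`. -/
noncomputable def index (a : _root_.stdSimplex ℝ (Fin (n + 1))) (t : Set.Ico (0 : ℝ) 1) :
    Fin (n + 1) := (exists_index a t).choose

lemma index_eq_iff (a : _root_.stdSimplex ℝ (Fin (n + 1))) (t : Set.Ico (0 : ℝ) 1)
    (i : Fin (n + 1)) :
    index a t = i ↔ t < partialSum a i ∧ ∀ j < i, partialSum a j ≤ t := by
  have h := (exists_index a t).choose_spec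
  constructor
  · rintro rfl
    exact h
  · intro h'
    rcases lt_trichotomy (index a t) i with hlt | heq | hgt
    · exact absurd h.1 (not_lt.2 (h'.2 _ hlt))
    · exact heq
    · exact absurd h'.1 (not_lt.2 (h.2 _ hgt))

lemma index_vertex (i : Fin (n + 1)) (t : Set.Ico (0 : ℝ) 1) :
    index (_root_.stdSimplex.vertex i) t = i := by
  rw [index_eq_iff]
  constructor
  · have : partialSum (_root_.stdSimplex.vertex i) i = 1 := by
      simp [partialSum]
    rw [this]
    exact t.2.2
  · intro j hj
    have : partialSum (_root_.stdSimplex.vertex i) j = 0 := by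
      simp [partialSum, hj]
    rw [this]
    exact t.2.1

/-- A monotone map merges consecutive steps or inserts steps of length zero, so it only relabels the
step containing `t`. -/
lemma index_simplexMap {m : ℕ} (f : ⦋m⦌ ⟶ ⦋n⦌) (a : _root_.stdSimplex ℝ (Fin (m + 1)))
    (t : Set.Ico (0 : ℝ) 1) : index (SSet.simplexMap f a) t = f (index a t) := by
  have hsum : ∀ k, partialSum (SSet.simplexMap f a) k = ∑ i with f i ≤ k, a.1 i := by
    intro k
    have : ∀ j, (SSet.simplexMap f a).1 j = ∑ i with f i = j, a.1 i :=
      fun j => SSet.simplexMap_apply f a j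
    simp only [partialSum, this]
    rw [Finset.sum_fiberwise_eq_sum_filter]
    simp
  have hmono : Monotone f := f.toOrderHom.monotone
  obtain ⟨h1, h2⟩ := (index_eq_iff a t _).1 rfl
  rw [index_eq_iff]
  constructor
  · rw [hsum]
    refine h1.trans_le (Finset.sum_le_sum_of_subset_of_nonneg ?_ fun i _ _ => a.2.1 i)
    intro i hi
    simp only [Finset.mem_filter, Finset.mem_univ, true_and] at hi ⊢
    exact hmono hi
  · intro k hk
    rw [hsum]
    by_cases h0 : ∃ i, f i ≤ k
    · obtain ⟨i₀, hi₀⟩ := h0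
      obtain ⟨i, hi, hmax⟩ := (Finset.univ.filter fun i => f i ≤ k).exists_maximal
        ⟨i₀, by simpa using hi₀⟩
      simp only [Finset.mem_filter, Finset.mem_univ, true_and] at hi hmax
      have hlt : i < index a t := by
        by_contra! hle
        exact absurd (hmono hle) (not_le.2 (hi.trans_lt hk))
      refine le_trans ?_ (h2 i hlt)
      refine Finset.sum_le_sum_of_subset_of_nonneg ?_ fun i _ _ => a.2.1 i
      intro j hj
      simp only [Finset.mem_filter, Finset.mem_univ, true_and] at hj ⊢
      rcases le_total j i with h | h
      · exact h
      · exact hmax hj h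
    · push Not at h0
      rw [Finset.filter_false_of_mem fun i _ => not_le.2 (h0 i)]
      exact t.2.1

/-- The step function with values `p` and step lengths `a`. -/
noncomputable def step {G : Type u} (p : Fin (n + 1) → G) (a : _root_.stdSimplex ℝ (Fin (n + 1))) :
    StepFun G := fun t => p (index a t)

/-- The step functions can differ only at points lying between corresponding breakpoints. -/
lemma dist_step_le {G : Type u} (p : Fin (n + 1) → G) (a b : _root_.stdSimplex ℝ (Fin (n + 1))) :
    dist (step p a) (step p b) ≤ ∑ k, |partialSum b k - partialSum a k| := by
  have hsub : {t | step p a t ≠ step p b t} ⊆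
      ⋃ k : Fin (n + 1), ((↑) : Set.Ico (0 : ℝ) 1 → ℝ) ⁻¹' Set.uIcc (partialSum a k) (partialSum b k) := by
    intro t ht
    by_contra hcon
    refine ht (congrArg p ?_)
    simp only [Set.mem_iUnion, Set.mem_preimage, not_exists] at hcon
    have hiff : ∀ k, (t : ℝ) < partialSum a k ↔ (t : ℝ) < partialSum b k := by
      intro k
      have hk := hcon k
      rw [Set.mem_uIcc] at hk
      push Not at hk
      constructor
      · intro h
        by_contra! h'
        exact absurd h (not_lt.2 (hk.2 h').le)
      · intro h
        by_contra! h'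
        exact absurd h (not_lt.2 (hk.1 h').le)
    rw [eq_comm, index_eq_iff]
    obtain ⟨h1, h2⟩ := (index_eq_iff a t _).1 rfl
    exact ⟨(hiff _).1 h1, fun j hj => not_lt.1 fun h => absurd ((hiff j).2 h) (not_lt.2 (h2 j hj))⟩
  refine (measureReal_mono hsub).trans ((measureReal_iUnion_fintype_le _).trans ?_)
  refine Finset.sum_le_sum fun k _ => ?_
  have h1 : (volume : Measure (Set.Ico (0 : ℝ) 1))
      (((↑) : Set.Ico (0 : ℝ) 1 → ℝ) ⁻¹' Set.uIcc (partialSum a k) (partialSum b k)) ≤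
      ENNReal.ofReal |partialSum b k - partialSum a k| := by
    rw [volume_preimage_coe measurableSet_Ico.nullMeasurableSet measurableSet_uIcc,
      ← Real.volume_interval]
    exact measure_mono Set.inter_subset_left
  exact ENNReal.toReal_le_of_le_ofReal (abs_nonneg _) h1

lemma continuous_step {G : Type u} (p : Fin (n + 1) → G) : Continuous (step p) := by
  rw [continuous_iff_continuousAt]
  intro a
  rw [ContinuousAt, tendsto_iff_dist_tendsto_zero]
  have hc : Continuous fun b : _root_.stdSimplex ℝ (Fin (n + 1)) =>
      ∑ k, |partialSum a k - partialSum b k| :=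
    continuous_finsetSum _ fun k _ => (continuous_const.sub (continuous_partialSum k)).abs
  have h0 := hc.tendsto a
  simp only [sub_self, abs_zero, Finset.sum_const_zero] at h0
  exact squeeze_zero (fun _ => dist_nonneg) (fun b => dist_step_le p b a) h0

end stdSimplex
end

/-! ### Homomorphisms on the fundamental group from cocycles. -/

section

open CategoryTheory Opposite Simplicial unitInterval

namespace SSet

variable {X : SSet.{u}}

lemma realizationPoint_eq (x : X _⦋0⦌) :
    realizationPoint x = charMap x (_root_.stdSimplex.vertex 0) := by
  rw [realizationPoint, TopCat.toSSetObj₀Equiv_apply]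
  exact congrArg _ (Subsingleton.elim _ _)

lemma realizationPath_apply {x y : X _⦋0⦌} (e : Edge x y) (t : I) :
    e.realizationPath t = charMap e.edge (stdSimplexHomeomorphUnitInterval.symm t) := rfl

lemma symm_zero_eq_vertex :
    stdSimplexHomeomorphUnitInterval.symm 0 = _root_.stdSimplex.vertex (S := ℝ) 0 := by
  rw [Homeomorph.symm_apply_eq]
  rfl

lemma symm_one_eq_vertex :
    stdSimplexHomeomorphUnitInterval.symm 1 = _root_.stdSimplex.vertex (S := ℝ) 1 := by
  rw [Homeomorph.symm_apply_eq]
  rfl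

lemma charMap_vertex_zero {x y : X _⦋0⦌} (e : Edge x y) :
    charMap e.edge (_root_.stdSimplex.vertex 0) = realizationPoint x := by
  rw [← symm_zero_eq_vertex]
  exact realizationPath_aux e.edge 1 0 rfl e.src_eq

lemma charMap_vertex_one {x y : X _⦋0⦌} (e : Edge x y) :
    charMap e.edge (_root_.stdSimplex.vertex 1) = realizationPoint y := by
  rw [← symm_one_eq_vertex]
  exact realizationPath_aux e.edge 0 1 rfl e.tgt_eq

lemma step_vertex {G : Type u} {n : ℕ} (q : Fin (n + 1) → G) (i : Fin (n + 1)) :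
    _root_.stdSimplex.step q (_root_.stdSimplex.vertex i) = fun _ => q i := by
  funext t
  simp [_root_.stdSimplex.step, _root_.stdSimplex.index_vertex]

variable {G : Type u} [AddCommGroup G]

/-- Functions on the vertices of all simplices of `X` which are compatible with the simplicial
structure up to additive constants. They are equivalent to 1-cocycles on `X`. -/
structure Potential (X : SSet.{u}) (G : Type u) [AddCommGroup G] where
  val : ∀ n : ℕ, X _⦋n⦌ → Fin (n + 1) → G
  val_map : ∀ {m n : ℕ} (f : ⦋m⦌ ⟶ ⦋n⦌) (s : X _⦋n⦌),
    ∃ g : G, ∀ i, val m (X.map f.op s) i = g + val n s (f i)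

namespace Potential

variable (p : Potential X G)

/-- The value of the cocycle on a 1-simplex. -/
def jump (e : X _⦋1⦌) : G := p.val 1 e 1 - p.val 1 e 0

/-- Simplicial operators change the values by a constant only, which disappears in the orbit space.
-/
lemma exists_classifyingMap : ∃ F : C(SSet.toTop.obj X, StepFun.OrbitSpace G),
    ∀ (n : ℕ) (s : X _⦋n⦌) (a : _root_.stdSimplex ℝ (Fin (n + 1))),
      F (charMap s a) = StepFun.toOrbit (_root_.stdSimplex.step (p.val n s) a) := by
  obtain ⟨F, hF⟩ := exists_desc (X := X) (Z := StepFun.OrbitSpace G)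
    (fun n s => ⟨fun a => StepFun.toOrbit (_root_.stdSimplex.step (p.val n s) a),
      StepFun.isAddQuotientCoveringMap.continuous.comp (_root_.stdSimplex.continuous_step _)⟩)
    (fun m n f s => by
      ext a
      obtain ⟨g, hg⟩ := p.val_map f s
      refine StepFun.toOrbit_eq_iff.2 ⟨g, ?_⟩
      funext t
      simp only [StepFun.vadd_apply, _root_.stdSimplex.step, _root_.stdSimplex.index_simplexMap, hg])
  exact ⟨F, fun n s a => congrArg (fun f : C(_, StepFun.OrbitSpace G) => f a) (hF n s)⟩

/-- The lift of an edge is explicit: translated step functions running from the constant value at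
vertex 0 to the one at vertex 1. -/
lemma monodromy_edge {F : C(SSet.toTop.obj X, StepFun.OrbitSpace G)}
    (hF : ∀ (n : ℕ) (s : X _⦋n⦌) (a : _root_.stdSimplex ℝ (Fin (n + 1))),
      F (charMap s a) = StepFun.toOrbit (_root_.stdSimplex.step (p.val n s) a))
    {x y : X _⦋0⦌} (e : Edge x y)
    (f : StepFun.toOrbit (G := G) ⁻¹' {F (realizationPoint x)}) :
    (StepFun.isAddQuotientCoveringMap.isCoveringMap.monodromy
      (.mk (e.realizationPath.map F.continuous)) f).1 = p.jump e.edge +ᵥ f.1 := by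
  obtain ⟨f, hf⟩ := f
  have hf' : StepFun.toOrbit f = StepFun.toOrbit (_root_.stdSimplex.step (p.val 1 e.edge)
      (_root_.stdSimplex.vertex 0)) := by
    rw [← hF, charMap_vertex_zero]
    exact hf
  obtain ⟨g, rfl⟩ := StepFun.toOrbit_eq_iff.1 hf'
  have hend : p.jump e.edge +ᵥ (g +ᵥ _root_.stdSimplex.step (p.val 1 e.edge)
      (_root_.stdSimplex.vertex 0)) = g +ᵥ _root_.stdSimplex.step (p.val 1 e.edge)
      (_root_.stdSimplex.vertex 1) := by
    rw [step_vertex, step_vertex]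
    funext t
    show p.val 1 e.edge 1 - p.val 1 e.edge 0 + (g + p.val 1 e.edge 0) = g + p.val 1 e.edge 1
    abel
  have hvadd := StepFun.isAddQuotientCoveringMap (G := G)
  rw [hend]
  let Γ : _root_.Path (g +ᵥ _root_.stdSimplex.step (p.val 1 e.edge) (_root_.stdSimplex.vertex 0))
      (g +ᵥ _root_.stdSimplex.step (p.val 1 e.edge) (_root_.stdSimplex.vertex 1)) :=
    { toFun := fun t => g +ᵥ _root_.stdSimplex.step (p.val 1 e.edge)
        (stdSimplexHomeomorphUnitInterval.symm t)
      continuous_toFun := (hvadd.continuous_const_vadd g).comp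
        ((_root_.stdSimplex.continuous_step _).comp
          stdSimplexHomeomorphUnitInterval.symm.continuous)
      source' := by
        rw [symm_zero_eq_vertex]
      target' := by
        rw [symm_one_eq_vertex] }
  have hy : g +ᵥ _root_.stdSimplex.step (p.val 1 e.edge) (_root_.stdSimplex.vertex 1) ∈
      StepFun.toOrbit (G := G) ⁻¹' {F (realizationPoint y)} := by
    show StepFun.toOrbit _ = F (realizationPoint y)
    rw [← charMap_vertex_one e, hF]
    exact StepFun.toOrbit_eq_iff.2 ⟨g, rfl⟩
  have := StepFun.isAddQuotientCoveringMap.isCoveringMap.monodromy_eq_of_map_eq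
    (γ := .mk (e.realizationPath.map F.continuous))
    (ex := ⟨_, hf⟩) (ey := ⟨_, hy⟩) (.mk Γ) (by
      refine congrArg Path.Homotopic.Quotient.mk ?_
      ext t
      show StepFun.toOrbit (g +ᵥ _) = F (e.realizationPath t)
      rw [realizationPath_apply, hF]
      exact StepFun.toOrbit_eq_iff.2 ⟨g, rfl⟩)
  exact congrArg Subtype.val this

/-- A potential induces a homomorphism from the fundamental group, whose value on a loop made of
two edges is the difference of the jumps. -/
theorem exists_hom (x : X _⦋0⦌) :
    ∃ ψ : FundamentalGroup (SSet.toTop.obj X) (realizationPoint x) →* Multiplicative G,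
      ∀ (y : X _⦋0⦌) (e₁ e₂ : Edge x y),
        ψ (FundamentalGroup.fromPath (.mk (e₁.realizationPath.trans e₂.realizationPath.symm))) =
          Multiplicative.ofAdd (p.jump e₁.edge - p.jump e₂.edge) := by
  obtain ⟨F, hF⟩ := p.exists_classifyingMap
  have hcov := StepFun.isAddQuotientCoveringMap (G := G)
  obtain ⟨f, hf⟩ := hcov.surjective (F (realizationPoint x))
  let fx : StepFun.toOrbit (G := G) ⁻¹' {F (realizationPoint x)} := ⟨f, hf⟩
  -- Monodromy takes values in the opposite group, which is harmless as `G` is commutative.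
  let op := (MulOpposite.opMulEquiv (M := Multiplicative G)).symm.toMonoidHom
  refine ⟨(op.comp (hcov.fundamentalGroupToMulOpposite fx)).comp
    (FundamentalGroup.map F (realizationPoint x)), fun y e₁ e₂ => ?_⟩
  show MulOpposite.unop (hcov.fundamentalGroupToMulOpposite fx _) = _
  rw [← MulOpposite.op_inj, MulOpposite.op_unop, hcov.fundamentalGroupToMulOpposite_apply_eq_Iff]
  have hmap : FundamentalGroup.map F (realizationPoint x)
      (FundamentalGroup.fromPath (.mk (e₁.realizationPath.trans e₂.realizationPath.symm))) =
      (Path.Homotopic.Quotient.mk (e₁.realizationPath.map F.continuous)).trans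
        (Path.Homotopic.Quotient.mk (e₂.realizationPath.map F.continuous)).symm := by
    refine congrArg Path.Homotopic.Quotient.mk ?_
    exact (Path.map_trans _ _ _).trans (congrArg _ (Path.map_symm _ _).symm)
  rw [hmap, IsCoveringMap.monodromy_trans_apply]
  set m := hcov.isCoveringMap.monodromy (.mk (e₁.realizationPath.map F.continuous)) fx with hm
  have hm1 : m.1 = p.jump e₁.edge +ᵥ f := p.monodromy_edge hF e₁ fx
  let fx' : StepFun.toOrbit (G := G) ⁻¹' {F (realizationPoint x)} :=
    ⟨(p.jump e₁.edge - p.jump e₂.edge) +ᵥ f, by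
      rw [Set.mem_preimage, hcov.map_vadd]; exact hf⟩
  -- The lift of `e₂` from `fx'` ends where the lift of `e₁` from `fx` ends, so returning along `e₂`
  -- leads to `fx'`.
  have hm2 : m = hcov.isCoveringMap.monodromy (.mk (e₂.realizationPath.map F.continuous)) fx' := by
    apply Subtype.ext
    rw [p.monodromy_edge hF e₂ fx', hm1]
    show _ = _ +ᵥ ((p.jump e₁.edge - p.jump e₂.edge) +ᵥ f)
    rw [vadd_vadd]
    congr 1
    abel
  rw [hm2, ← IsCoveringMap.monodromy_trans_apply, Path.Homotopic.Quotient.trans_symm,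
    IsCoveringMap.monodromy_refl]
  rfl

end Potential

end SSet
end

/-! ### Low-dimensional simplices of the diagonal. -/

section

open CategoryTheory Opposite Simplicial

namespace SimpleDoubleCategory

variable {C : SimpleDoubleCategory.{u}}

lemma vertex_surjective (x : C.diagNT _⦋0⦌) : ∃ A, x = vertex A :=
  ⟨((x : ComposableArrows (C.HFun (Fin 1)) 0).obj 0).functor.obj 0,
    ComposableArrows.ext₀ (HFun.ext_functor (ComposableArrows.ext₀ rfl))⟩

lemma mk₁_hFun₁_eq {F G : C.HFun (Fin 2)} (α : F ⟶ G) :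
    ComposableArrows.mk₁ α = ComposableArrows.mk₁ (squareHom
      (f := F.functor.map (homOfLE (by decide : (0 : Fin 2) ≤ 1)))
      (f' := G.functor.map (homOfLE (by decide : (0 : Fin 2) ≤ 1)))
      (HFun.Hom.dist α (homOfLE (by decide : (0 : Fin 2) ≤ 1)))) := by
  obtain ⟨F⟩ := F
  obtain ⟨G⟩ := G
  obtain ⟨A, B, f, rfl⟩ := ComposableArrows.mk₁_surjective F
  obtain ⟨A', B', f', rfl⟩ := ComposableArrows.mk₁_surjective G
  refine congrArg ComposableArrows.mk₁ (HFun.Hom.ext (funext fun i => ?_))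
  match i with
  | 0 => rfl
  | 1 => rfl

/-- The square underlying a 1-simplex of the diagonal. -/
lemma dist_of_simplex (s : ComposableArrows (C.HFun (Fin 2)) 1) :
    C.Dist ((s.obj 0).functor.map (homOfLE (by decide : (0 : Fin 2) ≤ 1)))
      ((s.obj 1).functor.map (homOfLE (by decide : (0 : Fin 2) ≤ 1)))
      (HFun.Hom.app (s.map (homOfLE (by decide : (0 : Fin 2) ≤ 1))) 0)
      (HFun.Hom.app (s.map (homOfLE (by decide : (0 : Fin 2) ≤ 1))) 1) :=
  HFun.Hom.dist (s.map (homOfLE (by decide : (0 : Fin 2) ≤ 1))) _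

/-- For a face of a grid the extracted square is definitionally the expected one, which gives the
three face formulas below. -/
lemma eq_square (s : ComposableArrows (C.HFun (Fin 2)) 1) :
    (s : C.diagNT _⦋1⦌) = square (dist_of_simplex s) :=
  (ComposableArrows.mk₁_hom s).symm.trans (mk₁_hFun₁_eq _)

lemma square_surjective (s : C.diagNT _⦋1⦌) :
    ∃ (A B A' B' : C.Ob) (f : C.catM.Hom A B) (f' : C.catM.Hom A' B') (g : C.catE.Hom A A')
      (g' : C.catE.Hom B B') (h : C.Dist f f' g g'), s = square h :=
  ⟨_, _, _, _, _, _, _, _, _, eq_square s⟩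

/-- A pair of horizontally composable distinguished squares as a morphism of `T_2 C`. -/
def squareHom₂ {A₀ A₁ A₂ B₀ B₁ B₂ : C.Ob} {f₁ : C.catM.Hom A₀ A₁} {f₂ : C.catM.Hom A₁ A₂}
    {k₁ : C.catM.Hom B₀ B₁} {k₂ : C.catM.Hom B₁ B₂} {g₀ : C.catE.Hom A₀ B₀}
    {g₁ : C.catE.Hom A₁ B₁} {g₂ : C.catE.Hom A₂ B₂}
    (h₁ : C.Dist f₁ k₁ g₀ g₁) (h₂ : C.Dist f₂ k₂ g₁ g₂) :
    (⟨ComposableArrows.mk₂ (C := C.M) f₁ f₂⟩ : C.HFun (Fin 3)) ⟶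
      ⟨ComposableArrows.mk₂ (C := C.M) k₁ k₂⟩ where
  app X := match X with
    | 0 => g₀
    | 1 => g₁
    | 2 => g₂
  dist := by
    intro X Y k
    match X, Y, k with
    | 0, 0, _ => exact C.dist_hid g₀
    | 0, 1, _ => exact h₁
    | 0, 2, _ => exact C.dist_hcomp h₁ h₂
    | 1, 1, _ => exact C.dist_hid g₁
    | 1, 2, _ => exact h₂
    | 2, 2, _ => exact C.dist_hid g₂
    | 1, 0, k => exact absurd (leOfHom k) (by decide)
    | 2, 0, k => exact absurd (leOfHom k) (by decide)
    | 2, 1, k => exact absurd (leOfHom k) (by decide)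

section

variable {A₀ A₁ A₂ B₀ B₁ B₂ D₀ D₁ D₂ : C.Ob}
  {f₁ : C.catM.Hom A₀ A₁} {f₂ : C.catM.Hom A₁ A₂}
  {k₁ : C.catM.Hom B₀ B₁} {k₂ : C.catM.Hom B₁ B₂}
  {l₁ : C.catM.Hom D₀ D₁} {l₂ : C.catM.Hom D₁ D₂}
  {g₀ : C.catE.Hom A₀ B₀} {g₁ : C.catE.Hom A₁ B₁} {g₂ : C.catE.Hom A₂ B₂}
  {p₀ : C.catE.Hom B₀ D₀} {p₁ : C.catE.Hom B₁ D₁} {p₂ : C.catE.Hom B₂ D₂}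
  (h₁₁ : C.Dist f₁ k₁ g₀ g₁) (h₁₂ : C.Dist f₂ k₂ g₁ g₂)
  (h₂₁ : C.Dist k₁ l₁ p₀ p₁) (h₂₂ : C.Dist k₂ l₂ p₁ p₂)

/-- A 2 by 2 grid of distinguished squares as a 2-simplex of the diagonal. -/
def grid : C.diagNT _⦋2⦌ := ComposableArrows.mk₂ (squareHom₂ h₁₁ h₁₂) (squareHom₂ h₂₁ h₂₂)

lemma δ_two_grid : C.diagNT.δ 2 (grid h₁₁ h₁₂ h₂₁ h₂₂) = square h₁₁ :=
  eq_square (C.diagNT.δ 2 (grid h₁₁ h₁₂ h₂₁ h₂₂) : C.diagNT _⦋1⦌)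

lemma δ_zero_grid : C.diagNT.δ 0 (grid h₁₁ h₁₂ h₂₁ h₂₂) = square h₂₂ :=
  eq_square (C.diagNT.δ 0 (grid h₁₁ h₁₂ h₂₁ h₂₂) : C.diagNT _⦋1⦌)

lemma δ_one_grid : C.diagNT.δ 1 (grid h₁₁ h₁₂ h₂₁ h₂₂) =
    square (C.dist_vcomp (C.dist_hcomp h₁₁ h₁₂) (C.dist_hcomp h₂₁ h₂₂)) :=
  eq_square (C.diagNT.δ 1 (grid h₁₁ h₁₂ h₂₁ h₂₂) : C.diagNT _⦋1⦌)

end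

end SimpleDoubleCategory
end

/-! ### Edge paths in the realization and the paths of distinguished squares. -/

section

open CategoryTheory Opposite Simplicial unitInterval

namespace SSet

lemma quotient_cast_trans {Y : Type u} [TopologicalSpace Y] {x y z x' y' z' : Y}
    (p : Path.Homotopic.Quotient x y) (q : Path.Homotopic.Quotient y z)
    (hx : x' = x) (hy : y' = y) (hz : z' = z) :
    (p.trans q).cast hx hz = (p.cast hx hy).trans (q.cast hy hz) := by
  subst hx hy hz
  simp only [Path.Homotopic.Quotient.cast_rfl_rfl]

lemma quotient_cast_symm {Y : Type u} [TopologicalSpace Y] {x y x' y' : Y}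
    (p : Path.Homotopic.Quotient x y) (hx : x' = x) (hy : y' = y) :
    p.symm.cast hy hx = (p.cast hx hy).symm := by
  subst hx hy
  simp only [Path.Homotopic.Quotient.cast_rfl_rfl]

lemma quotient_cast_refl {Y : Type u} [TopologicalSpace Y] {x y : Y} (h h' : y = x) :
    (Path.Homotopic.Quotient.refl x).cast h h' = .refl y := by
  subst h
  exact Path.Homotopic.Quotient.cast_rfl_rfl _

lemma quotient_trans_insert {Y : Type u} [TopologicalSpace Y] {x y z : Y}
    (p : Path.Homotopic.Quotient x y) (q : Path.Homotopic.Quotient y z)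
    (r : Path.Homotopic.Quotient x y) (t : Path.Homotopic.Quotient x z) :
    (p.trans q).trans t.symm = (p.trans r.symm).trans ((r.trans q).trans t.symm) := by
  rw [Path.Homotopic.Quotient.trans_assoc, Path.Homotopic.Quotient.trans_assoc,
    Path.Homotopic.Quotient.trans_assoc, ← Path.Homotopic.Quotient.trans_assoc r.symm,
    Path.Homotopic.Quotient.symm_trans, Path.Homotopic.Quotient.refl_trans]

lemma quotient_trans_symm_symm {Y : Type u} [TopologicalSpace Y] {x y z : Y}
    (p : Path.Homotopic.Quotient x y) (q : Path.Homotopic.Quotient z y) :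
    (p.trans q.symm).symm = q.trans p.symm := by
  induction p using Path.Homotopic.Quotient.ind
  induction q using Path.Homotopic.Quotient.ind
  rw [← Path.Homotopic.Quotient.mk_symm, ← Path.Homotopic.Quotient.mk_trans,
    ← Path.Homotopic.Quotient.mk_symm, Path.trans_symm, Path.symm_symm,
    Path.Homotopic.Quotient.mk_trans, Path.Homotopic.Quotient.mk_symm]

variable {X : SSet.{u}}

lemma realizationPoint_injective : Function.Injective (realizationPoint (X := X)) := by
  let t₀ : Set.Ico (0 : ℝ) 1 := ⟨0, by simp⟩
  -- At `t = 0` the index is the first vertex with positive coordinate. Sending a point to that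
  -- vertex is a well-defined, in general discontinuous, retraction onto the vertices.
  obtain ⟨F, hF⟩ := exists_desc_fun (X := X) (fun n s a =>
      X.map (SimplexCategory.const ⦋0⦌ ⦋n⦌ (_root_.stdSimplex.index a t₀)).op s)
    (fun m n f s a => by
      rw [_root_.stdSimplex.index_simplexMap, ← map_comp_apply']
      rfl)
  intro x y h
  rw [realizationPoint_eq, realizationPoint_eq] at h
  have h' := congrArg F h
  rw [hF, hF] at h'
  have hid : ∀ i, SimplexCategory.const ⦋0⦌ ⦋0⦌ i = 𝟙 _ := fun i => Subsingleton.elim _ _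
  simpa [hid] using h'

/-- The homotopy class of the path of an edge, in terms of any simplex of which it is a face. -/
lemma mk_realizationPath {x y : X _⦋0⦌} (e : Edge x y) {n : ℕ} (s : X _⦋n⦌) (f : ⦋1⦌ ⟶ ⦋n⦌)
    (h : X.map f.op s = e.edge)
    (hx : realizationPoint x = charMap s (_root_.stdSimplex.vertex (f 0)))
    (hy : realizationPoint y = charMap s (_root_.stdSimplex.vertex (f 1))) :
    Path.Homotopic.Quotient.mk e.realizationPath =
      (simplexPath (charMap s) (_root_.stdSimplex.vertex (f 0))
        (_root_.stdSimplex.vertex (f 1))).cast hx hy := by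
  let q : _root_.Path (_root_.stdSimplex.vertex (S := ℝ) (f 0))
      (_root_.stdSimplex.vertex (S := ℝ) (f 1)) :=
    { toFun := fun t => simplexMap f (stdSimplexHomeomorphUnitInterval.symm t)
      continuous_toFun := (simplexMap f).continuous.comp
        stdSimplexHomeomorphUnitInterval.symm.continuous
      source' := by rw [symm_zero_eq_vertex, simplexMap_vertex]
      target' := by rw [symm_one_eq_vertex, simplexMap_vertex] }
  rw [simplexPath_eq _ (.mk q), ← Path.Homotopic.Quotient.mk_map, ← Path.Homotopic.Quotient.mk_cast]
  refine congrArg _ ?_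
  ext t
  show charMap e.edge _ = charMap s (simplexMap f _)
  rw [← h, charMap_map_apply]

/-- A property of paths starting at a vertex that is preserved when an edge is appended holds for
all paths between vertices. -/
theorem edge_induction {x : X _⦋0⦌}
    (Q : ∀ y : X _⦋0⦌, Path.Homotopic.Quotient (realizationPoint x) (realizationPoint y) → Prop)
    (hrefl : Q x (.refl _))
    (hedge : ∀ {y z : X _⦋0⦌} (e : Edge y z) (γ), Q y γ → Q z (γ.trans (.mk e.realizationPath)))
    (hsymm : ∀ {y z : X _⦋0⦌} (e : Edge y z) (γ),
      Q z γ → Q y (γ.trans (Path.Homotopic.Quotient.mk e.realizationPath).symm))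
    {y : X _⦋0⦌} (γ : Path.Homotopic.Quotient (realizationPoint x) (realizationPoint y)) :
    Q y γ := by
  have h0 := realizationPoint_eq x
  have key := edge_path_induction x y
    (fun p γ => ∀ (z : X _⦋0⦌) (hz : realizationPoint z = p), Q z (γ.cast h0 hz)) ?_ ?_ ?_
    (γ.cast h0.symm (realizationPoint_eq y).symm) y (realizationPoint_eq y)
  · rwa [Path.Homotopic.Quotient.cast_cast, Path.Homotopic.Quotient.cast_rfl_rfl] at key
  · intro s γ hγ z hz
    let e : Edge (X.δ 1 s) (X.δ 0 s) := Edge.mk' s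
    obtain rfl : z = X.δ 0 s := realizationPoint_injective (hz.trans (charMap_vertex_one e))
    have h1 : realizationPoint (X.δ 1 s) = charMap s (_root_.stdSimplex.vertex 0) :=
      (charMap_vertex_zero e).symm
    rw [quotient_cast_trans _ _ _ h1]
    have h2 := mk_realizationPath e s (𝟙 _) (by simp [e]) h1 hz
    exact h2 ▸ hedge e _ (hγ _ h1)
  · intro s γ hγ z hz
    let e : Edge (X.δ 1 s) (X.δ 0 s) := Edge.mk' s
    obtain rfl : z = X.δ 1 s := realizationPoint_injective (hz.trans (charMap_vertex_zero e))
    have h1 : realizationPoint (X.δ 0 s) = charMap s (_root_.stdSimplex.vertex 1) :=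
      (charMap_vertex_one e).symm
    rw [quotient_cast_trans _ _ _ h1, ← simplexPath_symm, quotient_cast_symm]
    have h2 := mk_realizationPath e s (𝟙 _) (by simp [e]) hz h1
    exact h2 ▸ hsymm e _ (hγ _ h1)
  · intro z hz
    obtain rfl : z = x := realizationPoint_injective (hz.trans h0.symm)
    rwa [quotient_cast_refl]

/-- The edges of a 2-simplex. -/
lemma mk_realizationPath_trans {x y z : X _⦋0⦌} {e₀₁ : Edge x y} {e₁₂ : Edge y z} {e₀₂ : Edge x z}
    (s : X _⦋2⦌) (h₂ : X.δ 2 s = e₀₁.edge) (h₀ : X.δ 0 s = e₁₂.edge) (h₁ : X.δ 1 s = e₀₂.edge) :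
    (Path.Homotopic.Quotient.mk e₀₁.realizationPath).trans (.mk e₁₂.realizationPath) =
      .mk e₀₂.realizationPath := by
  have hx : realizationPoint x = charMap s (_root_.stdSimplex.vertex 0) := by
    rw [← charMap_vertex_zero e₀₁, ← h₂]
    exact (charMap_map_apply _ _ _).trans (congrArg _ (simplexMap_vertex _ _))
  have hy : realizationPoint y = charMap s (_root_.stdSimplex.vertex 1) := by
    rw [← charMap_vertex_zero e₁₂, ← h₀]
    exact (charMap_map_apply _ _ _).trans (congrArg _ (simplexMap_vertex _ _))
  have hz : realizationPoint z = charMap s (_root_.stdSimplex.vertex 2) := by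
    rw [← charMap_vertex_one e₁₂, ← h₀]
    exact (charMap_map_apply _ _ _).trans (congrArg _ (simplexMap_vertex _ _))
  have e1 := mk_realizationPath e₀₁ s (SimplexCategory.δ 2) h₂ hx hy
  have e2 := mk_realizationPath e₁₂ s (SimplexCategory.δ 0) h₀ hy hz
  have e3 := mk_realizationPath e₀₂ s (SimplexCategory.δ 1) h₁ hx hz
  rw [e1, e2, e3]
  exact (quotient_cast_trans _ _ hx hy hz).symm.trans
    (congrArg (fun p => Path.Homotopic.Quotient.cast p hx hz) (simplexPath_trans _ _ _ _))

end SSet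

namespace SimpleDoubleCategory

variable {C : SimpleDoubleCategory.{u}}

/-- The point of the realization given by an object. -/
noncomputable abbrev point (A : C.Ob) : SSet.toTop.obj C.diagNT := SSet.realizationPoint (vertex A)

lemma point_injective : Function.Injective (point (C := C)) := fun _ _ h =>
  congrArg (fun x : ComposableArrows (C.HFun (Fin 1)) 0 => (x.obj 0).functor.obj 0)
    (SSet.realizationPoint_injective h)

/-- The homotopy class of the path of a distinguished square. -/
noncomputable def squarePath {A B A' B' : C.Ob} {f : C.catM.Hom A B} {f' : C.catM.Hom A' B'}
    {g : C.catE.Hom A A'} {g' : C.catE.Hom B B'} (h : C.Dist f f' g g') :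
    Path.Homotopic.Quotient (point A) (point B') :=
  .mk (squareEdge h).realizationPath

/-- The homotopy class of the path of a vertical morphism. -/
noncomputable abbrev vPath {A B : C.Ob} (g : C.catE.Hom A B) :
    Path.Homotopic.Quotient (point A) (point B) := squarePath (C.dist_hid g)

/-- The homotopy class of the path of a horizontal morphism. -/
noncomputable abbrev hPath {A B : C.Ob} (f : C.catM.Hom A B) :
    Path.Homotopic.Quotient (point A) (point B) := squarePath (C.dist_vid f)

lemma squarePath_trans {A₀ A₁ A₂ B₀ B₁ B₂ D₀ D₁ D₂ : C.Ob}
    {f₁ : C.catM.Hom A₀ A₁} {f₂ : C.catM.Hom A₁ A₂}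
    {k₁ : C.catM.Hom B₀ B₁} {k₂ : C.catM.Hom B₁ B₂}
    {l₁ : C.catM.Hom D₀ D₁} {l₂ : C.catM.Hom D₁ D₂}
    {g₀ : C.catE.Hom A₀ B₀} {g₁ : C.catE.Hom A₁ B₁} {g₂ : C.catE.Hom A₂ B₂}
    {p₀ : C.catE.Hom B₀ D₀} {p₁ : C.catE.Hom B₁ D₁} {p₂ : C.catE.Hom B₂ D₂}
    (h₁₁ : C.Dist f₁ k₁ g₀ g₁) (h₁₂ : C.Dist f₂ k₂ g₁ g₂)
    (h₂₁ : C.Dist k₁ l₁ p₀ p₁) (h₂₂ : C.Dist k₂ l₂ p₁ p₂)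
    {f : C.catM.Hom A₀ A₂} {l : C.catM.Hom D₀ D₂} {g : C.catE.Hom A₀ D₀} {p : C.catE.Hom A₂ D₂}
    (h : C.Dist f l g p) (hf : C.catM.comp f₁ f₂ = f) (hl : C.catM.comp l₁ l₂ = l)
    (hg : C.catE.comp g₀ p₀ = g) (hp : C.catE.comp g₂ p₂ = p) :
    (squarePath h₁₁).trans (squarePath h₂₂) = squarePath h := by
  subst hf hl hg hp
  exact SSet.mk_realizationPath_trans (grid h₁₁ h₁₂ h₂₁ h₂₂) (δ_two_grid _ _ _ _)
    (δ_zero_grid _ _ _ _) (δ_one_grid _ _ _ _)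

lemma vPath_trans {A B D : C.Ob} (g : C.catE.Hom A B) (g' : C.catE.Hom B D) :
    (vPath g).trans (vPath g') = vPath (C.catE.comp g g') :=
  squarePath_trans (C.dist_hid g) (C.dist_hid g) (C.dist_hid g') (C.dist_hid g') _
    (C.catM.id_comp _) (C.catM.id_comp _) rfl rfl

lemma hPath_trans {A B D : C.Ob} (f : C.catM.Hom A B) (f' : C.catM.Hom B D) :
    (hPath f).trans (hPath f') = hPath (C.catM.comp f f') :=
  squarePath_trans (C.dist_vid f) (C.dist_vid f') (C.dist_vid f) (C.dist_vid f') _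
    rfl rfl (C.catE.id_comp _) (C.catE.id_comp _)

section

variable {A B A' B' : C.Ob} {f : C.catM.Hom A B} {f' : C.catM.Hom A' B'}
  {g : C.catE.Hom A A'} {g' : C.catE.Hom B B'} (h : C.Dist f f' g g')

/-- The grid has `h` in its upper right corner and identity squares elsewhere, so `h` is also the
composite. The next lemma has `h` in the lower left corner instead. -/
lemma vPath_trans_hPath : (vPath g).trans (hPath f') = squarePath h :=
  squarePath_trans (C.dist_hid g) h (C.dist_vid _) (C.dist_vid f') h
    (C.catM.id_comp _) (C.catM.id_comp _) (C.catE.comp_id _) (C.catE.comp_id _)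

lemma hPath_trans_vPath : (hPath f).trans (vPath g') = squarePath h :=
  squarePath_trans (C.dist_vid f) (C.dist_vid _) h (C.dist_hid g') h
    (C.catM.comp_id _) (C.catM.comp_id _) (C.catE.id_comp _) (C.catE.id_comp _)

end

end SimpleDoubleCategory

/-! ### Relations among the classes of objects, and generation. -/

namespace SquaresCategory

open SimpleDoubleCategory

variable (C : SquaresCategory.{u})

/-- The class of the vertical path from the basepoint. -/
noncomputable def classE (A : C.Ob) : Path.Homotopic.Quotient (point C.O) (point A) :=
  .mk (C.pathE A)

/-- The class of the horizontal path from the basepoint. -/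
noncomputable def classM (A : C.Ob) : Path.Homotopic.Quotient (point C.O) (point A) :=
  .mk (C.pathM A)

lemma objClass_eq (A : C.Ob) :
    C.objClass A = FundamentalGroup.fromPath ((C.classE A).trans (C.classM A).symm) := rfl

lemma classE_trans {A B : C.Ob} (g : C.catE.Hom A B) :
    (C.classE A).trans (vPath g) = C.classE B := by
  refine (vPath_trans _ g).trans ?_
  rw [@Limits.IsInitial.hom_ext _ C.catE _ _ C.isInitialE (C.catE.comp _ g)
    (@Limits.IsInitial.to _ C.catE _ C.isInitialE B)]
  rfl

lemma vPath_eq {A B : C.Ob} (g : C.catE.Hom A B) :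
    vPath g = (C.classE A).symm.trans (C.classE B) := by
  rw [← C.classE_trans g, ← Path.Homotopic.Quotient.trans_assoc,
    Path.Homotopic.Quotient.symm_trans, Path.Homotopic.Quotient.refl_trans]

lemma classM_trans {A B : C.Ob} (f : C.catM.Hom A B) :
    (C.classM A).trans (hPath f) = C.classM B := by
  refine (hPath_trans _ f).trans ?_
  rw [@Limits.IsInitial.hom_ext _ C.catM _ _ C.isInitialM (C.catM.comp _ f)
    (@Limits.IsInitial.to _ C.catM _ C.isInitialM B)]
  rfl

lemma hPath_eq {A B : C.Ob} (f : C.catM.Hom A B) :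
    hPath f = (C.classM A).symm.trans (C.classM B) := by
  rw [← C.classM_trans f, ← Path.Homotopic.Quotient.trans_assoc,
    Path.Homotopic.Quotient.symm_trans, Path.Homotopic.Quotient.refl_trans]

section

variable {C} {A B A' B' : C.Ob} {f : C.catM.Hom A B} {f' : C.catM.Hom A' B'}
  {g : C.catE.Hom A A'} {g' : C.catE.Hom B B'} (h : C.Dist f f' g g')

/-- Along left and bottom edge the loop is e_A' m_A'⁻¹ m_B' e_B'⁻¹; the product is reversed because
multiplication in the fundamental group is. -/
lemma squareLoop_eq_left :
    FundamentalGroup.fromPath (((C.classE A).trans (squarePath h)).trans (C.classE B').symm) =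
      (C.objClass B')⁻¹ * C.objClass A' := by
  rw [FundamentalGroup.mul_def, FundamentalGroup.inv_def, objClass_eq, objClass_eq]
  show _ = ((C.classE A').trans (C.classM A').symm).trans ((C.classE B').trans (C.classM B').symm).symm
  rw [SSet.quotient_trans_symm_symm, ← vPath_trans_hPath, ← Path.Homotopic.Quotient.trans_assoc,
    classE_trans, hPath_eq]
  simp only [Path.Homotopic.Quotient.trans_assoc]

lemma squareLoop_eq_right :
    FundamentalGroup.fromPath (((C.classE A).trans (squarePath h)).trans (C.classE B').symm) =
      (C.objClass B)⁻¹ * C.objClass A := by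
  rw [FundamentalGroup.mul_def, FundamentalGroup.inv_def, objClass_eq, objClass_eq]
  show _ = ((C.classE A).trans (C.classM A).symm).trans ((C.classE B).trans (C.classM B).symm).symm
  rw [SSet.quotient_trans_symm_symm, ← hPath_trans_vPath, hPath_eq, vPath_eq]
  show ((C.classE A).trans _).trans _ = _
  simp only [Path.Homotopic.Quotient.trans_assoc, Path.Homotopic.Quotient.trans_symm,
    Path.Homotopic.Quotient.trans_refl]

end

lemma classE_O : C.classE C.O = .refl _ := by
  have e1 : @Limits.IsInitial.to _ C.catE _ C.isInitialE C.O = C.catE.id C.O :=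
    @Limits.IsInitial.hom_ext _ C.catE _ _ C.isInitialE _ _
  have h : C.classE C.O = vPath (C.catE.id C.O) := congrArg (vPath (C := C.toSimpleDoubleCategory)) e1
  rw [h, vPath_eq, Path.Homotopic.Quotient.symm_trans]

lemma classM_O : C.classM C.O = .refl _ := by
  have e1 : @Limits.IsInitial.to _ C.catM _ C.isInitialM C.O = C.catM.id C.O :=
    @Limits.IsInitial.hom_ext _ C.catM _ _ C.isInitialM _ _
  have h : C.classM C.O = hPath (C.catM.id C.O) := congrArg (hPath (C := C.toSimpleDoubleCategory)) e1
  rw [h, hPath_eq, Path.Homotopic.Quotient.symm_trans]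

lemma objClass_O : C.objClass C.O = 1 := by
  rw [objClass_eq, classE_O, ← classM_O, Path.Homotopic.Quotient.trans_symm]
  rfl

lemma objClass_square {A B A' B' : C.Ob} (h : C.HasSquare A B A' B') :
    (C.objClass B')⁻¹ * C.objClass A' = (C.objClass B)⁻¹ * C.objClass A := by
  obtain ⟨f, f', g, g', h⟩ := h
  rw [← squareLoop_eq_left h, squareLoop_eq_right h]

/-- A path from the basepoint to an object, closed up to a loop along the vertical morphism. -/
noncomputable def loopClass {A : C.Ob} (γ : Path.Homotopic.Quotient (point C.O) (point A)) : C.K₀ :=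
  FundamentalGroup.fromPath (γ.trans (C.classE A).symm)

/-- A detour to `O` and back along e_A is inserted between the two paths. -/
lemma loopClass_trans {A D : C.Ob} (γ : Path.Homotopic.Quotient (point C.O) (point A))
    (q : Path.Homotopic.Quotient (point A) (point D)) :
    C.loopClass (γ.trans q) = C.loopClass ((C.classE A).trans q) * C.loopClass γ := by
  rw [FundamentalGroup.mul_def]
  exact SSet.quotient_trans_insert γ q (C.classE A) (C.classE D)

lemma loopClass_classE (A : C.Ob) : C.loopClass (C.classE A) = 1 :=
  Path.Homotopic.Quotient.trans_symm _

lemma loopClass_symm {A D : C.Ob} (q : Path.Homotopic.Quotient (point A) (point D)) :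
    C.loopClass ((C.classE D).trans q.symm) = (C.loopClass ((C.classE A).trans q))⁻¹ := by
  have h := C.loopClass_trans ((C.classE D).trans q.symm) q
  rw [Path.Homotopic.Quotient.trans_assoc, Path.Homotopic.Quotient.symm_trans,
    Path.Homotopic.Quotient.trans_refl, loopClass_classE] at h
  exact (inv_eq_of_mul_eq_one_right h.symm).symm

lemma loopClass_of_loop (γ : Path.Homotopic.Quotient (point C.O) (point C.O)) :
    C.loopClass γ = FundamentalGroup.fromPath γ := by
  rw [loopClass, classE_O]
  have h : (Path.Homotopic.Quotient.refl (point C.O)).symm = .refl _ :=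
    (Path.Homotopic.Quotient.refl_trans _).symm.trans (Path.Homotopic.Quotient.trans_symm _)
  exact (congrArg _ h).trans (Path.Homotopic.Quotient.trans_refl _)

lemma exists_squareEdge_eq {A D : C.Ob} (e : SSet.Edge (X := C.diagNT) (vertex A) (vertex D)) :
    ∃ (B A' : C.Ob) (f : C.catM.Hom A B) (f' : C.catM.Hom A' D) (g : C.catE.Hom A A')
      (g' : C.catE.Hom B D) (h : C.Dist f f' g g'), e = squareEdge h := by
  obtain ⟨A₁, B, A', B', f, f', g, g', h, he⟩ := square_surjective e.edge
  obtain rfl : A₁ = A := point_injective (congrArg SSet.realizationPoint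
    ((squareEdge h).src_eq.symm.trans ((congrArg _ he.symm).trans e.src_eq)))
  obtain rfl : B' = D := point_injective (congrArg SSet.realizationPoint
    ((squareEdge h).tgt_eq.symm.trans ((congrArg _ he.symm).trans e.tgt_eq)))
  exact ⟨B, A', f, f', g, g', h, SSet.Edge.ext he⟩

lemma closure_objClass : Subgroup.closure (Set.range C.objClass) = ⊤ := by
  rw [eq_top_iff]
  intro γ _
  set H := Subgroup.closure (Set.range C.objClass)
  have hgen : ∀ A, C.objClass A ∈ H := fun A => Subgroup.subset_closure ⟨A, rfl⟩
  -- Every edge is a square, and its closed-up loop is a product of object classes and inverses.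
  -- Appending edges therefore keeps the loop class in `H`.
  have hsq : ∀ {A D : C.Ob} (e : SSet.Edge (X := C.diagNT) (vertex A) (vertex D)),
      C.loopClass ((C.classE A).trans (.mk e.realizationPath)) ∈ H := fun {A D} e => by
    obtain ⟨B, A', f, f', g, g', h, rfl⟩ := C.exists_squareEdge_eq e
    have := H.mul_mem (H.inv_mem (hgen D)) (hgen A')
    rwa [← squareLoop_eq_left h] at this
  have key := SSet.edge_induction (X := C.diagNT) (x := vertex C.O)
    (fun y γ => ∀ (A : C.Ob) (h : y = vertex A),
      C.loopClass (γ.cast rfl (congrArg SSet.realizationPoint h.symm)) ∈ H)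
    (fun A h => ?_) (fun {y z} e γ hγ D hD => ?_) (fun {y z} e γ hγ A hA => ?_) γ C.O rfl
  · have h := Path.Homotopic.Quotient.cast_rfl_rfl (FundamentalGroup.toPath γ)
    have key' : C.loopClass (FundamentalGroup.toPath γ) ∈ H := h ▸ key
    rw [loopClass_of_loop] at key'
    exact key'
  · obtain rfl : C.O = A := point_injective (congrArg SSet.realizationPoint h)
    rw [Path.Homotopic.Quotient.cast_rfl_rfl, ← classE_O, loopClass_classE]
    exact H.one_mem
  · subst hD
    obtain ⟨A, rfl⟩ := vertex_surjective y
    rw [Path.Homotopic.Quotient.cast_rfl_rfl, loopClass_trans]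
    exact H.mul_mem (hsq e) (Path.Homotopic.Quotient.cast_rfl_rfl γ ▸ hγ A rfl)
  · subst hA
    obtain ⟨D, rfl⟩ := vertex_surjective z
    rw [Path.Homotopic.Quotient.cast_rfl_rfl, loopClass_trans, loopClass_symm]
    exact H.mul_mem (H.inv_mem (hsq e)) (Path.Homotopic.Quotient.cast_rfl_rfl γ ▸ hγ D rfl)

end SquaresCategory
end

/-! ### The cocycle of a squares category and the isomorphism. -/

section

open CategoryTheory Opposite Simplicial

namespace SquaresCategory

open SimpleDoubleCategory

variable (C : SquaresCategory.{u})

/-- The class of an object in the group given by generators and relations. -/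
def presentedClass (A : C.Ob) : FreeAbelianGroup C.Ob ⧸ C.relations :=
  QuotientAddGroup.mk (FreeAbelianGroup.of A)

lemma presentedClass_O : C.presentedClass C.O = 0 :=
  (QuotientAddGroup.eq_zero_iff _).2 (AddSubgroup.subset_closure (Or.inl rfl))

lemma presentedClass_square {A B A' B' : C.Ob} (h : C.HasSquare A B A' B') :
    C.presentedClass A + C.presentedClass B' = C.presentedClass B + C.presentedClass A' := by
  rw [← sub_eq_zero]
  exact (QuotientAddGroup.eq_zero_iff _).2
    (AddSubgroup.subset_closure (Or.inr ⟨A, B, A', B', h, rfl⟩))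

/-- The potential on the diagonal of `N_• T_• C` given by the classes of objects. -/
def potential : SSet.Potential C.diagNT (FreeAbelianGroup C.Ob ⧸ C.relations) where
  -- Only the top row of the grid is used. The sign makes the jump of the horizontal `O → A` equal
  -- to -[A], so that the loop e_A m_A⁻¹ is sent to +[A].
  val n s i := -C.presentedClass
    (((s : ComposableArrows (C.HFun (Fin (n + 1))) n).obj 0).functor.obj i)
  val_map {m n} f s := by
    let σ : ComposableArrows (C.HFun (Fin (n + 1))) n := s
    -- The new top row is row `f 0`. By the square relation its difference from row 0 is the same in
    -- columns `f 0` and `f i`, so it does not depend on `i`.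
    refine ⟨C.presentedClass ((σ.obj 0).functor.obj (f 0)) -
      C.presentedClass ((σ.obj (f 0)).functor.obj (f 0)), fun i => ?_⟩
    have hle : f 0 ≤ f i := f.toOrderHom.monotone (Fin.zero_le i)
    have h := C.presentedClass_square ⟨_, _, _, _,
      HFun.Hom.dist (σ.map (homOfLE (Fin.zero_le (f 0)))) (homOfLE hle)⟩
    show -C.presentedClass ((σ.obj (f 0)).functor.obj (f i)) =
      _ + -C.presentedClass ((σ.obj 0).functor.obj (f i))
    rw [← sub_eq_zero] at h ⊢
    rw [← neg_eq_zero, ← h]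
    abel

lemma jump_square {A B A' B' : C.Ob} {f : C.catM.Hom A B} {f' : C.catM.Hom A' B'}
    {g : C.catE.Hom A A'} {g' : C.catE.Hom B B'} (h : C.Dist f f' g g') :
    C.potential.jump (square h) = C.presentedClass A - C.presentedClass B := by
  show -C.presentedClass B - -C.presentedClass A = _
  abel

lemma exists_hom_presented :
    ∃ ψ : C.K₀ →* Multiplicative (FreeAbelianGroup C.Ob ⧸ C.relations),
      ∀ A, ψ (C.objClass A) = Multiplicative.ofAdd (C.presentedClass A) := by
  obtain ⟨ψ, hψ⟩ := C.potential.exists_hom (vertex C.O)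
  refine ⟨ψ, fun A => (hψ (vertex A) (squareEdge (C.dist_hid _)) (squareEdge (C.dist_vid _))).trans ?_⟩
  refine congrArg Multiplicative.ofAdd ?_
  refine (congrArg₂ (· - ·) (C.jump_square (C.dist_hid _)) (C.jump_square (C.dist_vid _))).trans ?_
  simp [presentedClass_O]

/-- With upper left corner `O` the square relation reads [X] = [lower left][upper right], and the
two squares give both orders. -/
lemma commute_objClass
    (hC : ∀ A B : C.Ob, ∃ X : C.Ob, C.HasSquare C.O A B X ∧ C.HasSquare C.O B A X) (A B : C.Ob) :
    C.objClass A * C.objClass B = C.objClass B * C.objClass A := by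
  obtain ⟨X, h₁, h₂⟩ := hC A B
  have e₁ := C.objClass_square h₁
  have e₂ := C.objClass_square h₂
  rw [objClass_O, mul_one] at e₁ e₂
  rw [inv_mul_eq_iff_eq_mul, eq_mul_inv_iff_mul_eq] at e₁ e₂
  rw [e₁, e₂]

lemma mul_comm_K₀
    (hC : ∀ A B : C.Ob, ∃ X : C.Ob, C.HasSquare C.O A B X ∧ C.HasSquare C.O B A X) (x y : C.K₀) :
    x * y = y * x := by
  have hx : x ∈ Subgroup.closure (Set.range C.objClass) := C.closure_objClass ▸ Subgroup.mem_top x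
  have hy : y ∈ Subgroup.closure (Set.range C.objClass) := C.closure_objClass ▸ Subgroup.mem_top y
  have := Subgroup.isMulCommutative_closure (k := Set.range C.objClass) (by
    rintro _ ⟨A, rfl⟩ _ ⟨B, rfl⟩
    exact C.commute_objClass hC A B)
  exact congrArg Subtype.val
    (this.is_comm.comm (⟨x, hx⟩ : Subgroup.closure (Set.range C.objClass)) ⟨y, hy⟩)

end SquaresCategory
end

theorem mainTheorem1 (C : SquaresCategory.{u})
    (hC : ∀ A B : C.Ob, ∃ X : C.Ob, C.HasSquare C.O A B X ∧ C.HasSquare C.O B A X) :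
    ∃ φ : (FreeAbelianGroup C.Ob ⧸ C.relations) ≃+ Additive C.K₀,
      ∀ A : C.Ob, φ (QuotientAddGroup.mk (FreeAbelianGroup.of A)) =
        Additive.ofMul (C.objClass A) := by
  -- Commutativity is added to the existing group structure, as the universal property of the free
  -- abelian group needs it.
  let : AddCommGroup (Additive C.K₀) :=
    { (inferInstance : AddGroup (Additive C.K₀)) with
      add_comm := fun x y => congrArg Additive.ofMul (C.mul_comm_K₀ hC x.toMul y.toMul) }
  let c : C.Ob → Additive C.K₀ := fun A => Additive.ofMul (C.objClass A)
  have hsq : ∀ {A B A' B' : C.Ob}, C.HasSquare A B A' B' → c A + c B' = c B + c A' := by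
    intro A B A' B' h
    have : -c B' + c A' = -c B + c A := congrArg Additive.ofMul (C.objClass_square h)
    rw [← sub_eq_zero] at this ⊢
    rw [← neg_eq_zero, ← this]
    abel
  let φ : (FreeAbelianGroup C.Ob ⧸ C.relations) →+ Additive C.K₀ :=
    QuotientAddGroup.lift C.relations (FreeAbelianGroup.lift c) (by
      rw [SquaresCategory.relations, AddSubgroup.closure_le]
      rintro _ (rfl | ⟨A, B, A', B', h, rfl⟩)
      · exact (FreeAbelianGroup.lift_apply_of _ _).trans (congrArg Additive.ofMul C.objClass_O)
      · simp [AddMonoidHom.mem_ker, hsq h])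
  have hφ : ∀ A, φ (C.presentedClass A) = c A := fun A => FreeAbelianGroup.lift_apply_of _ _
  obtain ⟨ψ, hψ⟩ := C.exists_hom_presented
  -- The composite fixes the generators [A], so `φ` is injective.
  have hψφ : (MonoidHom.toAdditiveLeft ψ).comp φ = AddMonoidHom.id _ := by
    refine QuotientAddGroup.addMonoidHom_ext _ (FreeAbelianGroup.lift_ext _ _ fun A => ?_)
    exact (congrArg (MonoidHom.toAdditiveLeft ψ) (hφ A)).trans (hψ A)
  refine ⟨AddEquiv.ofBijective φ ⟨?_, ?_⟩, hφ⟩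
  · exact (Function.LeftInverse.injective (g := MonoidHom.toAdditiveLeft ψ)
      fun x => DFunLike.congr_fun hψφ x)
  · intro x
    have hx : x.toMul ∈ Subgroup.closure (Set.range C.objClass) :=
      C.closure_objClass ▸ Subgroup.mem_top _
    have hle : Subgroup.closure (Set.range C.objClass) ≤ (AddSubgroup.toSubgroup' φ.range) := by
      rw [Subgroup.closure_le]
      rintro _ ⟨A, rfl⟩
      exact ⟨C.presentedClass A, hφ A⟩
    exact hle hx
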